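/- Let $\mu$ be a probability measure on $\mathbb R$ that is symmetric about $0$, let $h\sim\mu$, and let $\theta_1$ be in the high temperature regime $0<\theta_1<1/\mathbb E[\operatorname{sech}^2(h)]$. For integers $1\le k\le n$ and a clique $S_0\subseteq\{1,\dots,n\}$ with $|S_0|=k$, the planted random field Curie--Weiss model is the law of $\sigma\in\{-1,1\}^n$ obtained by drawing $h_1,\dots,h_n$ i.i.d. from $\mu$ and then $\sigma$ from $$\mathbb P_{S_0}(\sigma\mid h_1,\dots,h_n)\ \propto\ \exp\Big(\frac{\theta_1}{2k}\Big(\sum_{i\in S_0}\sigma_i\Big)^2+\sum_{i=1}^n h_i\sigma_i\Big).$$ Let $\sigma^{(1)},\dots,\sigma^{(m)}$ be independent observations from this model, each with its own independent field, and for $S\subseteq\{1,\dots,n\}$ with $|S|=k$ put $$\phi_S=\frac1k\Big(\mathbf 1_S^\top\Big(\frac1m\sum_{l=1}^m\sigma^{(l)}\sigma^{(l)\top}\Big)\mathbf 1_S-k\Big).$$ Then there is a constant $C>0$, depending only on $\theta_1$ and $\mu$, such that for every $\varepsilon>0$, whenever $m\ge Ck\log n$, with probability $1-o(1)$ every maximizer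 $S_{\max}$ of $\phi_S$ over the sets $S$ with $|S|=k$ satisfies $$|S_0\,\Delta\,S_{\max}|\le\varepsilon k .$$ Here $o(1)$ tends to $0$ as $k\to\infty$, uniformly over all $n\ge k$, all $m\ge Ck\log n$ and all $S_0$ with $|S_0|=k$ (for fixed $\theta_1$, $\mu$ and $\varepsilon$). -/

import Mathlib

open MeasureTheory

noncomputable section

/-- A spin configuration on `n` sites; `ℤˣ = {1, -1}`. -/
abbrev SpinConfig (n : ℕ) : Type := Fin n → ℤˣ

/-- The real value `± 1` of the spin at site `i`. -/
def spin {n : ℕ} (σ : SpinConfig n) (i : Fin n) : ℝ := ((σ i : ℤ) : ℝ)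

/-- Unnormalised Gibbs weight of the planted random field Curie-Weiss model with clique `S`:
`exp (θ / (2 |S|) * (∑_{i ∈ S} σ_i)^2 + ∑_i h_i σ_i)`. -/
def gibbsWeight {n : ℕ} (θ : ℝ) (S : Finset (Fin n)) (h : Fin n → ℝ) (σ : SpinConfig n) : ℝ :=
  Real.exp (θ / (2 * (S.card : ℝ)) * (∑ i ∈ S, spin σ i) ^ 2 + ∑ i, h i * spin σ i)

/-- Conditional probability of the configuration `σ` given the field `h`. -/
def gibbsProb {n : ℕ} (θ : ℝ) (S : Finset (Fin n)) (h : Fin n → ℝ) (σ : SpinConfig n) : ℝ :=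
  gibbsWeight θ S h σ / ∑ τ : SpinConfig n, gibbsWeight θ S h τ

/-- Probability of `σ` in one observation: the field has i.i.d. coordinates of law `μ`
and is averaged out. -/
def plantedProb {n : ℕ} (θ : ℝ) (μ : Measure ℝ) (S : Finset (Fin n)) (σ : SpinConfig n) : ℝ :=
  ∫ h : Fin n → ℝ, gibbsProb θ S h σ ∂(Measure.pi fun _ : Fin n => μ)

/-- Probability of an event about `m` independent observations, each with its own independent
random field. -/
def sampleProb {n : ℕ} (θ : ℝ) (μ : Measure ℝ) (S : Finset (Fin n)) (m : ℕ)
    (E : Set (Fin m → SpinConfig n)) : ℝ :=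
  ∑ x : Fin m → SpinConfig n, E.indicator (fun y => ∏ l, plantedProb θ μ S (y l)) x

/-- Entry `(i, j)` of the empirical second moment matrix `(1 / m) ∑_l σ^(l) (σ^(l))ᵀ`. -/
def empiricalMoment {n m : ℕ} (x : Fin m → SpinConfig n) (i j : Fin n) : ℝ :=
  (1 / (m : ℝ)) * ∑ l, spin (x l) i * spin (x l) j

/-- The scan statistic `φ_S = (1 / k) (1_Sᵀ Ê[σ σᵀ] 1_S - k)`. -/
def scanStat {n m : ℕ} (k : ℕ) (x : Fin m → SpinConfig n) (S : Finset (Fin n)) : ℝ :=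
  (1 / (k : ℝ)) * ((∑ i ∈ S, ∑ j ∈ S, empiricalMoment x i j) - (k : ℝ))

/-- `S` maximises the scan statistic over all `k`-element subsets of the sites. -/
def IsScanMaximizer {n m : ℕ} (k : ℕ) (x : Fin m → SpinConfig n) (S : Finset (Fin n)) : Prop :=
  S.card = k ∧ ∀ S' : Finset (Fin n), S'.card = k → scanStat k x S' ≤ scanStat k x S

end

/-! A Chernoff bound and a union bound over all competitors show that, with high probability, the
clique `S` is the only maximizer; approximate recovery follows for every ε with the same constant.

Write `M_A` for the total spin over `A`, `X = M_S² / k`, `l = |S' \ S|` and `η = l / k`. The core is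
`exists_plantedMean_exp_le`: for a small fixed `s`, one observation satisfies `E exp ((s/k) (M_{S'}²
- M_S²)) ≤ exp (-c η)`. Over `m` independent observations this becomes `exp (-c l m / k)`, and `|S Δ
S'| = 2l`, so the union bound is dominated by a binomial sum `(1 + y)^n - 1` with `y = exp (-c m /
(2k)) ≤ n⁻²`.

The one-observation bound has two ingredients. First, the law is invariant under permutations of the
clique and, the field being symmetric, under sign changes outside it. Hence `S'` may be replaced by
a random exchange: a uniform `l`-subset of `S` is removed and `l` independent signs are added. The
fluctuation is sub-Gaussian (Serfling and Hoeffding), and linearising the square by a Gaussian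
integral bounds the conditional expectation by the exponential of `s η (-(2 - η)(X - 1) + small)`
(`sum_exchange_exp_le`).

Second, `X` has mean above 1 by a constant, even after truncation (`exists_plantedMean_min_ge`).
Given the field, the law is a product measure tilted by `exp (θ X / 2)`; Chebyshev's association
inequality turns the tilt into a gain proportional to the variance of a truncation of `X`. Averaged
over the field, one replica of the product measure is uniform, and two replicas sharing a field have
an explicit overlap law, so that this variance reduces to Rademacher moments. It stays away from 0
because `E tanh² h < 1`. -/

/-! ### Sub-Gaussian bounds for sampling without replacement -/

/-- Hoeffding's lemma for the uniform distribution on a finite set. -/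
theorem sum_exp_mul_sub_mean_le {ι : Type*} [Fintype ι] [DecidableEq ι] (S : Finset ι)
    (f : ι → ℝ) (hf : ∀ i ∈ S, f i ∈ Set.Icc (-1 : ℝ) 1) (c : ℝ) :
    ∑ i ∈ S, Real.exp (c * (f i - (∑ j ∈ S, f j) / S.card)) ≤
      S.card * Real.exp (c ^ 2 / 2) := by
  rcases S.eq_empty_or_nonempty with rfl | hS
  · simp
  have hcard : (0 : ℝ) < S.card := by exact_mod_cast hS.card_pos
  let _ : MeasurableSpace ι := ⊤
  set P := PMF.uniformOfFinset S hS with hP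
  have hint : ∀ g : ι → ℝ, ∫ i, g i ∂P.toMeasure = (∑ i ∈ S, g i) / S.card := by
    intro g
    rw [PMF.integral_eq_sum, Finset.sum_div, ← Finset.sum_subset (Finset.subset_univ S)]
    · refine Finset.sum_congr rfl fun i hi => ?_
      simp [hP, PMF.uniformOfFinset_apply, hi]
      field_simp
    · intro i _ hi
      simp [hP, PMF.uniformOfFinset_apply, hi]
  have hae : ∀ᵐ i ∂P.toMeasure, f i ∈ Set.Icc (-1 : ℝ) 1 := by
    have h0 : P.toMeasure {i | i ∈ S}ᶜ = 0 := by
      rw [PMF.toMeasure_apply_eq_zero_iff _ (MeasurableSet.of_discrete)]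
      rw [hP, PMF.support_uniformOfFinset]
      exact Set.disjoint_left.2 fun a ha hb => hb ha
    have h1 : ∀ᵐ i ∂P.toMeasure, i ∈ S := h0
    filter_upwards [h1] with i hi using hf i hi
  have h := (ProbabilityTheory.hasSubgaussianMGF_of_mem_Icc (μ := P.toMeasure)
    (measurable_from_top (f := f)).aemeasurable hae).mgf_le c
  rw [ProbabilityTheory.mgf, hint, hint] at h
  rw [div_le_iff₀ hcard] at h
  refine h.trans_eq ?_
  rw [mul_comm]
  congr 2
  have : ‖(1 : ℝ) - -1‖₊ = 2 := by
    ext; norm_num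
  rw [this]
  norm_num

/-- Double counting of the pairs `i ∈ D`, `D` of size `l + 1`. -/
theorem sum_sum_powersetCard_erase {ι : Type*} [DecidableEq ι] (S : Finset ι) (l : ℕ)
    (G : Finset ι → ℝ) :
    ∑ i ∈ S, ∑ D ∈ (S.erase i).powersetCard l, G (insert i D) =
      (l + 1) * ∑ D ∈ S.powersetCard (l + 1), G D := by
  have h1 : (l + 1 : ℝ) * ∑ D ∈ S.powersetCard (l + 1), G D =
      ∑ D ∈ S.powersetCard (l + 1), ∑ i ∈ D, G D := by
    rw [Finset.mul_sum]
    refine Finset.sum_congr rfl fun D hD => ?_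
    rw [Finset.sum_const, (Finset.mem_powersetCard.1 hD).2]
    simp
  rw [h1, Finset.sum_sigma', Finset.sum_sigma']
  refine Finset.sum_bij' (fun p _ => ⟨insert p.1 p.2, p.1⟩) (fun p _ => ⟨p.2, p.1.erase p.2⟩)
    ?_ ?_ ?_ ?_ ?_
  · rintro ⟨i, D⟩ h
    simp only [Finset.mem_sigma, Finset.mem_powersetCard] at h ⊢
    obtain ⟨hi, hD, hc⟩ := h
    have hiD : i ∉ D := fun hh => by simpa using hD hh
    refine ⟨⟨Finset.insert_subset hi (hD.trans (Finset.erase_subset _ _)), ?_⟩,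
      Finset.mem_insert_self _ _⟩
    rw [Finset.card_insert_of_notMem hiD, hc]
  · rintro ⟨D, i⟩ h
    simp only [Finset.mem_sigma, Finset.mem_powersetCard] at h ⊢
    obtain ⟨⟨hD, hc⟩, hi⟩ := h
    refine ⟨hD hi, Finset.erase_subset_erase _ hD, ?_⟩
    rw [Finset.card_erase_of_mem hi, hc]; rfl
  · rintro ⟨i, D⟩ h
    simp only [Finset.mem_sigma, Finset.mem_powersetCard] at h
    have hiD : i ∉ D := fun hh => by simpa using h.2.1 hh
    simp [Finset.erase_insert hiD]
  · rintro ⟨D, i⟩ h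
    simp only [Finset.mem_sigma] at h
    simp [Finset.insert_erase h.2]
  · rintro ⟨i, D⟩ _
    rfl

/-- Serfling's inequality: exponential moments of a sum sampled without replacement. -/
theorem sum_powersetCard_exp_le {ι : Type*} [Fintype ι] [DecidableEq ι] (f : ι → ℝ) (c : ℝ)
    (l : ℕ) : ∀ S : Finset ι, l ≤ S.card → (∀ i ∈ S, f i ∈ Set.Icc (-1 : ℝ) 1) →
    ∑ D ∈ S.powersetCard l, Real.exp (c * (∑ i ∈ D, f i - l * ((∑ j ∈ S, f j) / S.card))) ≤
      (S.card.choose l : ℝ) *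
        Real.exp (c ^ 2 * ((l : ℝ) * (S.card - l + 1) / S.card) / 2) := by
  induction l with
  | zero => intro S _ _; simp
  | succ l ih =>
    intro S hl hf
    obtain ⟨k, hk⟩ : ∃ k, S.card = k + 1 := ⟨S.card - 1, by omega⟩
    set x := (∑ j ∈ S, f j) / S.card with hx
    have hlk : (l : ℝ) ≤ k := by exact_mod_cast (by omega : l ≤ k)
    have hkk : ((S.card : ℕ) : ℝ) = k + 1 := by rw [hk]; push_cast; ring
    have hxs : ∑ j ∈ S, f j = (k + 1) * x := by
      rw [hx, hkk]; field_simp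
    -- Single out one drawn element `i`. The rest is a sample of size `l` from `S.erase i`, whose
    -- mean differs from `x` by `-(f i - x) / k`; the centred sum is therefore the centred sum of
    -- the rest plus `((k - l) / k) (f i - x)`.
    have key : ∀ i ∈ S, ∑ D ∈ (S.erase i).powersetCard l,
        Real.exp (c * (∑ j ∈ insert i D, f j - (l + 1 : ℕ) * x)) ≤
        (k.choose l : ℝ) * Real.exp (c ^ 2 * ((l : ℝ) * (k - l + 1) / k) / 2) *
          Real.exp ((c * ((k - l) / k)) * (f i - x)) := by
      intro i hi
      have hc : (S.erase i).card = k := by rw [Finset.card_erase_of_mem hi, hk]; rfl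
      have hih := ih (S.erase i) (by omega) fun j hj => hf j (Finset.mem_of_mem_erase hj)
      rw [hc] at hih
      have hs : ∑ j ∈ S.erase i, f j = (k + 1) * x - f i := by
        rw [← hxs, ← Finset.add_sum_erase S f hi]; ring
      rw [hs] at hih
      refine le_trans (le_of_eq ?_)
        (mul_le_mul_of_nonneg_right hih (Real.exp_nonneg _))
      rw [Finset.sum_mul]
      refine Finset.sum_congr rfl fun D hD => ?_
      have hiD : i ∉ D := fun hh => by simpa using (Finset.mem_powersetCard.1 hD).1 hh
      rw [← Real.exp_add, Finset.sum_insert hiD]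
      congr 1
      -- For `k = 0` the set is the singleton `{i}` and the quotients by `k` take the default value
      -- 0, so this case is checked by hand.
      rcases Nat.eq_zero_or_pos k with h0 | hpos
      · have hl0 : l = 0 := by omega
        have hS1 : S = {i} := by
          apply (Finset.eq_of_subset_of_card_le (Finset.singleton_subset_iff.2 hi) _).symm
          simp [hk, h0]
        have hxi : x = f i := by
          rw [hx, hS1]; simp
        subst hl0
        have hD0 : D = ∅ := by simpa using hD
        subst hD0
        subst h0
        simp [hxi]
      · have hkp : (0 : ℝ) < k := by exact_mod_cast hpos
        push_cast
        field_simp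
        ring
    have h2 := sum_exp_mul_sub_mean_le S f hf (c * ((k - l) / k))
    rw [← hx] at h2
    have h3 := sum_sum_powersetCard_erase S l
      fun D => Real.exp (c * (∑ j ∈ D, f j - (l + 1 : ℕ) * x))
    have hl1 : (0 : ℝ) < l + 1 := by positivity
    have h4 : (l + 1 : ℝ) * ∑ D ∈ S.powersetCard (l + 1),
        Real.exp (c * (∑ j ∈ D, f j - (l + 1 : ℕ) * x)) ≤
        (k.choose l : ℝ) * Real.exp (c ^ 2 * ((l : ℝ) * (k - l + 1) / k) / 2) *
          ((k + 1) * Real.exp ((c * ((k - l) / k)) ^ 2 / 2)) := by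
      rw [← h3]
      refine (Finset.sum_le_sum key).trans ?_
      rw [← Finset.mul_sum, ← hkk]
      gcongr
    have h5 : ((k + 1 : ℝ)) * (k.choose l : ℝ) = ((k + 1).choose (l + 1) : ℝ) * (l + 1) := by
      exact_mod_cast Nat.add_one_mul_choose_eq k l
    -- The variance proxy closes under the recursion: the gap between the two sides is `(k - l) l /
    -- (k² (k + 1))`.
    have hV : (l : ℝ) * (k - l + 1) / k + ((k - l) / k) ^ 2 ≤
        ((l + 1 : ℕ) : ℝ) * (S.card - (l + 1 : ℕ) + 1) / S.card := by
      rw [hkk]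
      push_cast
      rcases Nat.eq_zero_or_pos k with h0 | hpos
      · have hl0 : l = 0 := by omega
        subst h0; subst hl0; simp
      · have hkp : (0 : ℝ) < k := by exact_mod_cast hpos
        have : (l + 1 : ℝ) * (k + 1 - (l + 1) + 1) / (k + 1) -
            ((l : ℝ) * (k - l + 1) / k + ((k - l) / k) ^ 2) =
            (k - l) * l / (k ^ 2 * (k + 1)) := by
          field_simp
          ring
        have h0 : 0 ≤ (k - l) * l / ((k : ℝ) ^ 2 * (k + 1)) :=
          div_nonneg (mul_nonneg (by linarith) (by positivity)) (by positivity)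
        linarith
    refine le_of_mul_le_mul_left (h4.trans ?_) hl1
    calc _ = ((k + 1 : ℝ) * (k.choose l : ℝ)) *
          Real.exp (c ^ 2 * ((l : ℝ) * (k - l + 1) / k + ((k - l) / k) ^ 2) / 2) := by
          rw [show c ^ 2 * ((l : ℝ) * (k - l + 1) / k + ((k - l) / k) ^ 2) / 2 =
            c ^ 2 * ((l : ℝ) * (k - l + 1) / k) / 2 + (c * ((k - l) / k)) ^ 2 / 2 by ring,
            Real.exp_add]
          ring
      _ ≤ ((k + 1 : ℝ) * (k.choose l : ℝ)) * Real.exp (c ^ 2 *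
          (((l + 1 : ℕ) : ℝ) * (S.card - (l + 1 : ℕ) + 1) / S.card) / 2) := by
          gcongr
      _ = _ := by rw [h5, hk]; ring

/-! ### Gaussian linearisation of squares -/

/-- Gaussian integral with a linear term. -/
theorem integral_exp_neg_mul_sq_add_mul {b : ℝ} (hb : 0 < b) (d : ℝ) :
    Integrable (fun z : ℝ => Real.exp (-b * z ^ 2 + d * z)) ∧
    ∫ z : ℝ, Real.exp (-b * z ^ 2 + d * z) =
      √(Real.pi / b) * Real.exp (d ^ 2 / (4 * b)) := by
  have h : (fun z : ℝ => Real.exp (-b * z ^ 2 + d * z)) =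
      fun z => Real.exp (-b * (z - d / (2 * b)) ^ 2) * Real.exp (d ^ 2 / (4 * b)) := by
    ext z
    rw [← Real.exp_add]
    congr 1
    field_simp
    ring
  rw [h]
  constructor
  · exact ((integrable_exp_neg_mul_sq hb).comp_sub_right (d / (2 * b))).mul_const _
  · rw [integral_mul_const,
      integral_sub_right_eq_self (fun z : ℝ => Real.exp (-b * z ^ 2)) (d / (2 * b)),
      integral_gaussian]

/-- Exponential moments of a quadratic function of a sub-Gaussian variable. -/
theorem sum_exp_sq_add_le_of_subgaussian {ι : Type*} (A : Finset ι) (p g : ι → ℝ)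
    {v t : ℝ} (ht : 0 ≤ t) (hvt : 2 * t * v < 1)
    (hmgf : ∀ c : ℝ, ∑ i ∈ A, p i * Real.exp (c * g i) ≤ Real.exp (c ^ 2 * v / 2)) (c : ℝ) :
    ∑ i ∈ A, p i * Real.exp (t * g i ^ 2 + c * g i) ≤
      1 / √(1 - 2 * t * v) * Real.exp (c ^ 2 * v / (2 * (1 - 2 * t * v))) := by
  set b := 1 - 2 * t * v with hb
  have hbpos : 0 < b := by linarith
  have hpi : 0 < √Real.pi := Real.sqrt_pos.2 Real.pi_pos
  have hst : √t * √t = t := Real.mul_self_sqrt ht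
  -- Hubbard–Stratonovich: `exp (t y²)` is a Gaussian average of exponentials linear in `y`, to
  -- which the moment hypothesis applies with parameter `2√t z + c`. The remaining Gaussian weight
  -- has rate `b = 1 - 2tv > 0`.
  have hG : ∀ y : ℝ, Integrable (fun z : ℝ =>
      Real.exp (-1 * z ^ 2 + (2 * √t * y) * z) * Real.exp (c * y)) ∧
      ∫ z : ℝ, Real.exp (-1 * z ^ 2 + (2 * √t * y) * z) * Real.exp (c * y) =
        √Real.pi * Real.exp (t * y ^ 2 + c * y) := by
    intro y
    obtain ⟨h1, h2⟩ := integral_exp_neg_mul_sq_add_mul one_pos (2 * √t * y)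
    refine ⟨h1.mul_const _, ?_⟩
    rw [integral_mul_const, h2, div_one, mul_assoc, ← Real.exp_add]
    congr 2
    linear_combination y ^ 2 * hst
  have hint : √Real.pi * ∑ i ∈ A, p i * Real.exp (t * g i ^ 2 + c * g i) =
      ∫ z : ℝ, ∑ i ∈ A, p i *
        (Real.exp (-1 * z ^ 2 + (2 * √t * g i) * z) * Real.exp (c * g i)) := by
    rw [integral_finsetSum _ fun i _ => (hG (g i)).1.const_mul _, Finset.mul_sum]
    refine Finset.sum_congr rfl fun i _ => ?_
    rw [integral_const_mul, (hG (g i)).2]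
    ring
  obtain ⟨h1, h2⟩ := integral_exp_neg_mul_sq_add_mul hbpos (2 * √t * c * v)
  have hle : ∫ z : ℝ, ∑ i ∈ A, p i *
        (Real.exp (-1 * z ^ 2 + (2 * √t * g i) * z) * Real.exp (c * g i)) ≤
      ∫ z : ℝ, Real.exp (-b * z ^ 2 + (2 * √t * c * v) * z) * Real.exp (c ^ 2 * v / 2) := by
    refine integral_mono (integrable_finsetSum _ fun i _ => (hG (g i)).1.const_mul _)
      (h1.mul_const _) fun z => ?_
    have := mul_le_mul_of_nonneg_left (hmgf (2 * √t * z + c)) (Real.exp_nonneg (-1 * z ^ 2))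
    refine le_trans (le_of_eq ?_) (this.trans_eq ?_)
    · rw [Finset.mul_sum]
      refine Finset.sum_congr rfl fun i _ => ?_
      rw [← Real.exp_add, mul_left_comm, ← Real.exp_add]
      congr 2
      ring
    · rw [← Real.exp_add, ← Real.exp_add]
      congr 1
      rw [hb]
      linear_combination (2 * z ^ 2 * v) * hst
  rw [← hint, integral_mul_const, h2] at hle
  refine le_of_mul_le_mul_left (hle.trans_eq ?_) hpi
  rw [Real.sqrt_div Real.pi_pos.le, mul_assoc, ← Real.exp_add]
  have : (2 * √t * c * v) ^ 2 / (4 * b) + c ^ 2 * v / 2 = c ^ 2 * v / (2 * b) := by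
    field_simp
    rw [hb]
    linear_combination (8 * c ^ 2 * v ^ 2) * hst
  rw [this]
  ring

/-- The first-order term `u / 2` must be sharp: it later cancels the drift at `X = 1`. Only the
second-order term may be crude. -/
theorem one_div_sqrt_one_sub_le {u : ℝ} (h0 : 0 ≤ u) (h1 : u ≤ 1 / 2) :
    1 / √(1 - u) ≤ Real.exp (u / 2 + u ^ 2 / 2) := by
  have hpos : 0 < 1 - u := by linarith
  rw [div_le_iff₀ (Real.sqrt_pos.2 hpos)]
  have h2 : Real.exp (u / 2 + u ^ 2 / 2) = √(Real.exp (u + u ^ 2)) := by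
    rw [← Real.exp_half]; congr 1; ring
  rw [h2, ← Real.sqrt_mul (Real.exp_nonneg _), Real.one_le_sqrt]
  have h3 : 1 + (u + u ^ 2) ≤ Real.exp (u + u ^ 2) := by
    linarith [Real.add_one_le_exp (u + u ^ 2)]
  have h4 := Real.quadratic_le_exp_of_nonneg (show 0 ≤ u + u ^ 2 by positivity)
  nlinarith [mul_le_mul_of_nonneg_right h4 hpos.le, mul_nonneg h0 h0, mul_nonneg (mul_nonneg h0 h0) (sub_nonneg.2 h1)]

/-! ### Random signs and the exchange estimate -/

theorem spin_eq_one_or {n : ℕ} (σ : SpinConfig n) (i : Fin n) : spin σ i = 1 ∨ spin σ i = -1 := by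
  rcases Int.units_eq_one_or (σ i) with h | h <;> simp [spin, h]

theorem spin_sq {n : ℕ} (σ : SpinConfig n) (i : Fin n) : spin σ i ^ 2 = 1 := by
  rcases spin_eq_one_or σ i with h | h <;> simp [h]

theorem spin_mem_Icc {n : ℕ} (σ : SpinConfig n) (i : Fin n) :
    spin σ i ∈ Set.Icc (-1 : ℝ) 1 := by
  rcases spin_eq_one_or σ i with h | h <;> simp [h]

theorem spin_mul {n : ℕ} (σ τ : SpinConfig n) (i : Fin n) :
    spin (σ * τ) i = spin σ i * spin τ i := by
  simp [spin]

theorem sum_units_int (f : ℤˣ → ℝ) : ∑ u, f u = f 1 + f (-1) := by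
  rw [show (Finset.univ : Finset ℤˣ) = {1, -1} from rfl, Finset.sum_pair (by decide)]

theorem sum_spinConfig_prod {n : ℕ} (φ : Fin n → ℤˣ → ℝ) :
    ∑ ε : SpinConfig n, ∏ i, φ i (ε i) = ∏ i, (φ i 1 + φ i (-1)) := by
  simp_rw [← sum_units_int]
  rw [Finset.prod_univ_sum, Fintype.piFinset_univ]

theorem sum_spinConfig_exp {n : ℕ} (σ : SpinConfig n) (B : Finset (Fin n)) (c : ℝ) :
    ∑ ε : SpinConfig n, Real.exp (c * ∑ i ∈ B, spin ε i * spin σ i) =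
      2 ^ n * Real.cosh c ^ B.card := by
  have h : ∀ ε : SpinConfig n, Real.exp (c * ∑ i ∈ B, spin ε i * spin σ i) =
      ∏ i, (if i ∈ B then Real.exp (c * (((ε i : ℤ) : ℝ) * spin σ i)) else 1) := by
    intro ε
    rw [Finset.mul_sum, Real.exp_sum, Finset.prod_ite_mem, Finset.univ_inter]
    rfl
  simp_rw [h]
  rw [sum_spinConfig_prod fun i u => if i ∈ B then Real.exp (c * (((u : ℤ) : ℝ) * spin σ i)) else 1]
  have h2 : ∀ i, ((if i ∈ B then Real.exp (c * ((((1 : ℤˣ) : ℤ) : ℝ) * spin σ i)) else 1) +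
      (if i ∈ B then Real.exp (c * ((((-1 : ℤˣ) : ℤ) : ℝ) * spin σ i)) else 1)) =
      2 * (if i ∈ B then Real.cosh c else 1) := by
    intro i
    split_ifs
    · rcases spin_eq_one_or σ i with h | h <;> simp [h, Real.cosh_eq] <;> ring
    · norm_num
  simp_rw [h2]
  rw [Finset.prod_mul_distrib, Finset.prod_ite_mem]
  simp

theorem sum_spinConfig_exp_le {n : ℕ} (σ : SpinConfig n) (B : Finset (Fin n)) (c : ℝ) :
    ∑ ε : SpinConfig n, Real.exp (c * ∑ i ∈ B, spin ε i * spin σ i) ≤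
      2 ^ n * Real.exp (c ^ 2 * B.card / 2) := by
  rw [sum_spinConfig_exp]
  gcongr
  calc Real.cosh c ^ B.card ≤ Real.exp (c ^ 2 / 2) ^ B.card := by
        gcongr
        exact Real.cosh_le_exp_half_sq c
    _ = _ := by rw [← Real.exp_nat_mul]; congr 1; ring

/-- Exchanging a random `l`-subset of `S` for `l` sites with random signs:
exponential moment of the change of the squared total spin. -/
theorem sum_exchange_exp_le {n k l : ℕ} (σ : SpinConfig n) (S B : Finset (Fin n))
    (hS : S.card = k) (hB : B.card = l) (hl : 1 ≤ l) (hlk : l ≤ k) {s X η : ℝ} (hs : 0 ≤ s)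
    (hs' : s ≤ 1 / 12) (hη : η = l / k) (hX : X = (∑ i ∈ S, spin σ i) ^ 2 / k) :
    ∑ ε : SpinConfig n, ∑ D ∈ S.powersetCard l,
      Real.exp (s / k * ((∑ i ∈ S, spin σ i - ∑ i ∈ D, spin σ i +
        ∑ i ∈ B, spin ε i * spin σ i) ^ 2 - (∑ i ∈ S, spin σ i) ^ 2)) ≤
      2 ^ n * (k.choose l : ℝ) *
        Real.exp (s * η * (-(2 - η) * (X - 1) + 1 / k + 18 * s + 12 * s * X)) := by
  have hl0 : (0 : ℝ) < l := by exact_mod_cast hl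
  have hk0 : (0 : ℝ) < k := by exact_mod_cast (by omega : 0 < k)
  have hlk' : (l : ℝ) ≤ k := by exact_mod_cast hlk
  have hη0 : 0 < η := by rw [hη]; positivity
  have hη1 : η ≤ 1 := by rw [hη, div_le_one hk0]; exact hlk'
  have hC : (0 : ℝ) < k.choose l := by exact_mod_cast Nat.choose_pos hlk
  have hk1 : (1 : ℝ) / k ≤ 1 := by
    rw [div_le_one hk0]; exact_mod_cast (by omega : 1 ≤ k)
  have hk1' : (0 : ℝ) ≤ 1 / k := by positivity
  set x := (∑ i ∈ S, spin σ i) / k with hx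
  have hM : ∑ i ∈ S, spin σ i = k * x := by rw [hx]; field_simp
  have hXx : X = k * x ^ 2 := by rw [hX, hM]; field_simp
  have hlη : (l : ℝ) = η * k := by rw [hη]; field_simp
  -- Variance proxy of the fluctuation `g`: `l` from the signs on `B`, the rest from Serfling's
  -- inequality for `D`.
  set v : ℝ := l + l * (k - l + 1) / k with hv
  have hv' : v = l * (2 - η + 1 / k) := by rw [hv, hη]; field_simp; ring
  have hv0 : 0 ≤ v := by rw [hv']; apply mul_nonneg hl0.le; linarith
  have hv3 : v ≤ 3 * l := by rw [hv']; nlinarith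
  set u := 2 * (s / k) * v with hu
  have hu' : u = 2 * (s * η * (2 - η + 1 / k)) := by
    rw [hu, hv', hη]; ring
  have hu0 : 0 ≤ u := by rw [hu]; positivity
  have hsη : 0 ≤ s * η := by positivity
  have hu6 : u ≤ 6 * (s * η) := by
    rw [hu']; nlinarith
  have hu1 : u ≤ 1 / 2 := by nlinarith
  set g : SpinConfig n × Finset (Fin n) → ℝ := fun q =>
    ∑ i ∈ B, spin q.1 i * spin σ i - (∑ i ∈ q.2, spin σ i - l * x) with hg
  have hmgf : ∀ c : ℝ, ∑ q ∈ Finset.univ ×ˢ S.powersetCard l,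
      (1 / (2 ^ n * (k.choose l : ℝ))) * Real.exp (c * g q) ≤ Real.exp (c ^ 2 * v / 2) := by
    intro c
    rw [← Finset.mul_sum, Finset.sum_product]
    have h1 := sum_spinConfig_exp_le σ B c
    have h2 := sum_powersetCard_exp_le (fun i => spin σ i) (-c) l S (by omega)
      fun i _ => spin_mem_Icc σ i
    rw [hS, ← hx] at h2
    rw [hB] at h1
    have h3 : ∑ ε : SpinConfig n, ∑ D ∈ S.powersetCard l, Real.exp (c * g (ε, D)) =
        (∑ ε : SpinConfig n, Real.exp (c * ∑ i ∈ B, spin ε i * spin σ i)) *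
        ∑ D ∈ S.powersetCard l, Real.exp (-c * (∑ i ∈ D, spin σ i - l * x)) := by
      rw [Finset.sum_mul_sum]
      refine Finset.sum_congr rfl fun ε _ => Finset.sum_congr rfl fun D _ => ?_
      rw [← Real.exp_add, hg]
      congr 1
      ring
    rw [h3, one_div, inv_mul_le_iff₀ (by positivity)]
    refine (mul_le_mul h1 h2 (Finset.sum_nonneg fun _ _ => Real.exp_nonneg _)
      (by positivity)).trans_eq ?_
    rw [show c ^ 2 * v / 2 = c ^ 2 * l / 2 + (-c) ^ 2 * (l * (k - l + 1) / k) / 2 by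
      rw [hv]; ring, Real.exp_add]
    ring
  -- The new total spin is `(k - l) x + g`; expanding its square times `s / k` gives the linear
  -- coefficient `2 s (1 - η) x`.
  have hmain := sum_exp_sq_add_le_of_subgaussian (Finset.univ ×ˢ S.powersetCard l)
    (fun _ => 1 / (2 ^ n * (k.choose l : ℝ))) g (v := v) (t := s / k) (by positivity)
    (by rw [← hu]; linarith) hmgf (2 * s * (1 - η) * x)
  rw [← Finset.mul_sum, Finset.sum_product, one_div (2 ^ n * (k.choose l : ℝ)),
    inv_mul_le_iff₀ (by positivity)] at hmain
  have hsplit : ∀ ε : SpinConfig n, ∀ D : Finset (Fin n),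
      Real.exp (s / k * ((∑ i ∈ S, spin σ i - ∑ i ∈ D, spin σ i +
        ∑ i ∈ B, spin ε i * spin σ i) ^ 2 - (∑ i ∈ S, spin σ i) ^ 2)) =
      Real.exp (-(s * η * (2 - η) * X)) *
        Real.exp (s / k * g (ε, D) ^ 2 + 2 * s * (1 - η) * x * g (ε, D)) := by
    intro ε D
    rw [← Real.exp_add]
    congr 1
    have : ∑ i ∈ S, spin σ i - ∑ i ∈ D, spin σ i + ∑ i ∈ B, spin ε i * spin σ i =
        (k - l) * x + g (ε, D) := by
      rw [hM, hg]; ring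
    rw [this, hM, hXx, hlη]
    field_simp
    ring
  simp_rw [hsplit, ← Finset.mul_sum]
  calc _ ≤ Real.exp (-(s * η * (2 - η) * X)) * (2 ^ n * (k.choose l : ℝ) *
        (Real.exp (u / 2 + u ^ 2 / 2) * Real.exp (12 * s ^ 2 * η * X))) := by
        gcongr
        refine hmain.trans ?_
        rw [← hu]
        gcongr
        · exact one_div_sqrt_one_sub_le hu0 hu1
        · rw [div_le_iff₀ (by linarith)]
          have h12 : (2 * s * (1 - η) * x) ^ 2 * v ≤ 12 * s ^ 2 * η * X := by
            have e1 : 12 * s ^ 2 * η * X = (4 * s ^ 2 * x ^ 2) * (3 * l) := by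
              rw [hXx, hlη]; ring
            have e2 : (2 * s * (1 - η) * x) ^ 2 ≤ 4 * s ^ 2 * x ^ 2 := by
              have : (1 - η) ^ 2 ≤ 1 := by nlinarith
              calc (2 * s * (1 - η) * x) ^ 2 = (4 * s ^ 2 * x ^ 2) * (1 - η) ^ 2 := by ring
                _ ≤ (4 * s ^ 2 * x ^ 2) * 1 := by gcongr
                _ = _ := by ring
            rw [e1]
            exact mul_le_mul e2 hv3 hv0 (by positivity)
          refine h12.trans ?_
          have : 0 ≤ 12 * s ^ 2 * η * X := by rw [hXx]; positivity
          nlinarith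
    _ = 2 ^ n * (k.choose l : ℝ) * Real.exp (-(s * η * (2 - η) * X) +
        (u / 2 + u ^ 2 / 2) + 12 * s ^ 2 * η * X) := by
        rw [← Real.exp_add (u / 2 + u ^ 2 / 2), mul_left_comm, ← Real.exp_add]
        congr 2
        ring
    _ ≤ _ := by
        gcongr
        have : u ^ 2 ≤ 36 * s * (s * η) := by
          calc u ^ 2 ≤ (6 * (s * η)) ^ 2 := by gcongr
            _ = (36 * s * (s * η)) * η := by ring
            _ ≤ (36 * s * (s * η)) * 1 := by gcongr
            _ = _ := by ring
        -- This term supplies the `-1` in `X - 1`: to first order in `s`, and up to `1 / k`, the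
        -- drift vanishes at `X = 1`, the mean for independent uniform spins.
        rw [show u / 2 = s * η * (2 - η + 1 / k) by rw [hu']; ring]
        linarith

/-! ### The planted law and its symmetries -/

noncomputable section

theorem gibbsWeight_pos {n : ℕ} (θ : ℝ) (S : Finset (Fin n)) (h : Fin n → ℝ)
    (σ : SpinConfig n) : 0 < gibbsWeight θ S h σ := Real.exp_pos _

theorem sum_gibbsWeight_pos {n : ℕ} (θ : ℝ) (S : Finset (Fin n)) (h : Fin n → ℝ) :
    0 < ∑ τ : SpinConfig n, gibbsWeight θ S h τ :=
  Finset.sum_pos (fun τ _ => gibbsWeight_pos θ S h τ) Finset.univ_nonempty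

theorem gibbsProb_nonneg {n : ℕ} (θ : ℝ) (S : Finset (Fin n)) (h : Fin n → ℝ)
    (σ : SpinConfig n) : 0 ≤ gibbsProb θ S h σ :=
  div_nonneg (gibbsWeight_pos θ S h σ).le (sum_gibbsWeight_pos θ S h).le

theorem sum_gibbsProb {n : ℕ} (θ : ℝ) (S : Finset (Fin n)) (h : Fin n → ℝ) :
    ∑ σ : SpinConfig n, gibbsProb θ S h σ = 1 := by
  simp only [gibbsProb]
  rw [← Finset.sum_div, div_self (sum_gibbsWeight_pos θ S h).ne']

theorem gibbsProb_le_one {n : ℕ} (θ : ℝ) (S : Finset (Fin n)) (h : Fin n → ℝ)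
    (σ : SpinConfig n) : gibbsProb θ S h σ ≤ 1 := by
  rw [← sum_gibbsProb θ S h]
  exact Finset.single_le_sum (fun τ _ => gibbsProb_nonneg θ S h τ) (Finset.mem_univ σ)

theorem continuous_gibbsProb {n : ℕ} (θ : ℝ) (S : Finset (Fin n)) (σ : SpinConfig n) :
    Continuous fun h : Fin n → ℝ => gibbsProb θ S h σ := by
  have hw : ∀ τ : SpinConfig n, Continuous fun h : Fin n → ℝ => gibbsWeight θ S h τ := by
    intro τ
    unfold gibbsWeight
    fun_prop
  unfold gibbsProb
  exact (hw σ).div (continuous_finsetSum _ fun τ _ => hw τ)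
    fun h => (sum_gibbsWeight_pos θ S h).ne'

variable {n : ℕ} (θ : ℝ) (μ : Measure ℝ) (S : Finset (Fin n))

theorem plantedProb_nonneg (σ : SpinConfig n) : 0 ≤ plantedProb θ μ S σ :=
  integral_nonneg fun h => gibbsProb_nonneg θ S h σ

/-- Expectation of `F` under one observation of the planted model. -/
def plantedMean (F : SpinConfig n → ℝ) : ℝ := ∑ σ, plantedProb θ μ S σ * F σ

theorem plantedMean_mono {F G : SpinConfig n → ℝ} (h : ∀ σ, F σ ≤ G σ) :
    plantedMean θ μ S F ≤ plantedMean θ μ S G :=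
  Finset.sum_le_sum fun σ _ => mul_le_mul_of_nonneg_left (h σ) (plantedProb_nonneg θ μ S σ)

theorem sum_plantedMean {ι : Type*} (A : Finset ι) (F : ι → SpinConfig n → ℝ) :
    ∑ q ∈ A, plantedMean θ μ S (F q) = plantedMean θ μ S fun σ => ∑ q ∈ A, F q σ := by
  simp only [plantedMean, Finset.mul_sum]
  exact Finset.sum_comm

variable [IsProbabilityMeasure μ]

theorem integrable_gibbsProb (σ : SpinConfig n) :
    Integrable (fun h : Fin n → ℝ => gibbsProb θ S h σ) (Measure.pi fun _ => μ) := by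
  refine Integrable.of_bound (continuous_gibbsProb θ S σ).aestronglyMeasurable 1
    (Filter.Eventually.of_forall fun h => ?_)
  rw [Real.norm_of_nonneg (gibbsProb_nonneg θ S h σ)]
  exact gibbsProb_le_one θ S h σ

theorem sum_plantedProb : ∑ σ : SpinConfig n, plantedProb θ μ S σ = 1 := by
  simp only [plantedProb]
  rw [← integral_finsetSum _ fun σ _ => integrable_gibbsProb θ μ S σ]
  simp [sum_gibbsProb]

theorem plantedMean_eq_integral (F : SpinConfig n → ℝ) :
    plantedMean θ μ S F =
      ∫ h, ∑ σ, gibbsProb θ S h σ * F σ ∂(Measure.pi fun _ : Fin n => μ) := by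
  rw [integral_finsetSum _ fun σ _ => (integrable_gibbsProb θ μ S σ).mul_const _]
  simp only [plantedMean, plantedProb, integral_mul_const]

/-- Sites outside the clique enter the weight only through `h i * σ i`, so a sign change there is
absorbed by the field. -/
theorem gibbsProb_flip (e : SpinConfig n) (he : ∀ i ∈ S, e i = 1) (h : Fin n → ℝ)
    (σ : SpinConfig n) :
    gibbsProb θ S (fun i => spin e i * h i) (e * σ) = gibbsProb θ S h σ := by
  have hw : ∀ τ : SpinConfig n,
      gibbsWeight θ S (fun i => spin e i * h i) (e * τ) = gibbsWeight θ S h τ := by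
    intro τ
    have h1 : ∑ i ∈ S, spin (e * τ) i = ∑ i ∈ S, spin τ i :=
      Finset.sum_congr rfl fun i hi => by simp [spin, he i hi]
    have h2 : ∑ i, spin e i * h i * spin (e * τ) i = ∑ i, h i * spin τ i := by
      refine Finset.sum_congr rfl fun i _ => ?_
      rw [spin_mul]
      linear_combination (h i * spin τ i) * spin_sq e i
    rw [gibbsWeight, gibbsWeight, h1, h2]
  unfold gibbsProb
  rw [hw, ← Equiv.sum_comp (Equiv.mulLeft e) fun τ => gibbsWeight θ S _ τ]
  simp [hw]

theorem measurePreserving_flip (hμ : μ.map (fun x : ℝ => -x) = μ) (e : SpinConfig n) :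
    MeasurePreserving (fun (h : Fin n → ℝ) i => spin e i * h i)
      (Measure.pi fun _ => μ) (Measure.pi fun _ => μ) := by
  refine measurePreserving_pi (fun _ => μ) (fun _ => μ) (f := fun i x => spin e i * x) fun i => ?_
  rcases spin_eq_one_or e i with h | h
  · simpa [h] using! MeasurePreserving.id μ
  · simp only [h, neg_mul, one_mul]
    exact ⟨measurable_neg, hμ⟩

theorem plantedProb_flip (hμ : μ.map (fun x : ℝ => -x) = μ) (e : SpinConfig n)
    (he : ∀ i ∈ S, e i = 1) (σ : SpinConfig n) :
    plantedProb θ μ S (e * σ) = plantedProb θ μ S σ := by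
  have h := measurePreserving_flip μ hμ e
  have h2 : ∫ x, gibbsProb θ S x (e * σ) ∂(Measure.pi fun _ : Fin n => μ) =
      ∫ x, gibbsProb θ S (fun i => spin e i * x i) (e * σ) ∂(Measure.pi fun _ : Fin n => μ) := by
    conv_lhs => rw [← h.map_eq]
    exact integral_map h.measurable.aemeasurable
      (continuous_gibbsProb θ S (e * σ)).aestronglyMeasurable
  unfold plantedProb
  rw [h2]
  simp only [gibbsProb_flip θ S e he]

theorem plantedMean_flip (hμ : μ.map (fun x : ℝ => -x) = μ) (e : SpinConfig n)
    (he : ∀ i ∈ S, e i = 1) (F : SpinConfig n → ℝ) :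
    plantedMean θ μ S (fun σ => F (e * σ)) = plantedMean θ μ S F := by
  unfold plantedMean
  rw [← Equiv.sum_comp (Equiv.mulLeft e) fun σ => plantedProb θ μ S σ * F σ]
  refine Finset.sum_congr rfl fun σ _ => ?_
  rw [Equiv.coe_mulLeft, plantedProb_flip θ μ S hμ e he]

theorem sum_perm_eq_of_mapsTo (π : Equiv.Perm (Fin n)) {A B : Finset (Fin n)}
    (hAB : ∀ i ∈ A, π i ∈ B) (hc : A.card = B.card) (f : Fin n → ℝ) :
    ∑ i ∈ A, f (π i) = ∑ i ∈ B, f i := by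
  have : A.map π.toEmbedding = B := by
    apply Finset.eq_of_subset_of_card_le
    · intro i hi
      obtain ⟨j, hj, rfl⟩ := Finset.mem_map.1 hi
      exact hAB j hj
    · simp [hc]
  rw [← this, Finset.sum_map]
  rfl

theorem gibbsProb_perm (π : Equiv.Perm (Fin n)) (hπ : ∀ i ∈ S, π i ∈ S) (h : Fin n → ℝ)
    (σ : SpinConfig n) :
    gibbsProb θ S (fun i => h (π i)) (fun i => σ (π i)) = gibbsProb θ S h σ := by
  have hw : ∀ τ : SpinConfig n,
      gibbsWeight θ S (fun i => h (π i)) (fun i => τ (π i)) = gibbsWeight θ S h τ := by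
    intro τ
    have h1 : ∑ i ∈ S, spin (fun i => τ (π i)) i = ∑ i ∈ S, spin τ i :=
      sum_perm_eq_of_mapsTo π hπ rfl fun i => spin τ i
    have h2 : ∑ i, h (π i) * spin (fun i => τ (π i)) i = ∑ i, h i * spin τ i :=
      Equiv.sum_comp π fun i => h i * spin τ i
    rw [gibbsWeight, gibbsWeight, h1, h2]
  unfold gibbsProb
  rw [hw, ← Equiv.sum_comp (Equiv.arrowCongr π.symm (Equiv.refl ℤˣ))]
  congr 1
  exact Finset.sum_congr rfl fun τ _ => hw τ

theorem plantedProb_perm (π : Equiv.Perm (Fin n)) (hπ : ∀ i ∈ S, π i ∈ S)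
    (σ : SpinConfig n) :
    plantedProb θ μ S (fun i => σ (π i)) = plantedProb θ μ S σ := by
  have h : MeasurePreserving (fun (h : Fin n → ℝ) i => h (π i))
      (Measure.pi fun _ => μ) (Measure.pi fun _ => μ) :=
    measurePreserving_arrowCongr' (fun _ => μ) (fun _ => μ) π.symm (MeasurableEquiv.refl ℝ)
      fun _ => MeasurePreserving.id μ
  have h2 : ∫ x, gibbsProb θ S x (fun i => σ (π i)) ∂(Measure.pi fun _ : Fin n => μ) =
      ∫ x, gibbsProb θ S (fun i => x (π i)) (fun i => σ (π i))
        ∂(Measure.pi fun _ : Fin n => μ) := by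
    conv_lhs => rw [← h.map_eq]
    exact integral_map h.measurable.aemeasurable
      (continuous_gibbsProb θ S _).aestronglyMeasurable
  unfold plantedProb
  rw [h2]
  simp only [gibbsProb_perm θ S π hπ]

theorem plantedMean_perm (π : Equiv.Perm (Fin n)) (hπ : ∀ i ∈ S, π i ∈ S)
    (F : SpinConfig n → ℝ) :
    plantedMean θ μ S (fun σ => F (fun i => σ (π i))) = plantedMean θ μ S F := by
  unfold plantedMean
  rw [← Equiv.sum_comp (Equiv.arrowCongr π.symm (Equiv.refl ℤˣ))
    fun σ => plantedProb θ μ S σ * F σ]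
  refine Finset.sum_congr rfl fun σ _ => ?_
  rw [← plantedProb_perm θ μ S π hπ σ]
  rfl

theorem exists_perm_mapsTo {A B : Finset (Fin n)} (hA : A ⊆ S) (hB : B ⊆ S)
    (hc : A.card = B.card) :
    ∃ π : Equiv.Perm (Fin n), (∀ i ∈ A, π i ∈ B) ∧ (∀ i ∈ S, π i ∈ S) ∧
      ∀ i, i ∉ S → π i = i := by
  have hcard : ∀ A : Finset (Fin n), A ⊆ S → Fintype.card {x : {i // i ∈ S} // x.1 ∈ A} = A.card := by
    intro A hA
    rw [← Fintype.card_coe A]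
    exact Fintype.card_congr ⟨fun x => ⟨x.1.1, x.2⟩, fun x => ⟨⟨x.1, hA x.2⟩, x.2⟩,
      fun _ => rfl, fun _ => rfl⟩
  let e : {x : {i // i ∈ S} // x.1 ∈ A} ≃ {x : {i // i ∈ S} // x.1 ∈ B} :=
    Fintype.equivOfCardEq (by rw [hcard A hA, hcard B hB, hc])
  refine ⟨Equiv.Perm.ofSubtype e.extendSubtype, fun i hi => ?_, fun i hi => ?_, fun i hi => ?_⟩
  · rw [Equiv.Perm.ofSubtype_apply_of_mem _ (hA hi)]
    exact e.extendSubtype_mem ⟨i, hA hi⟩ hi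
  · rw [Equiv.Perm.ofSubtype_apply_of_mem _ hi]
    exact (e.extendSubtype ⟨i, hi⟩).2
  · exact Equiv.Perm.ofSubtype_apply_of_not_mem _ hi

/-- Exponential moment of the difference of squared total spins over `S'` and the clique `S`,
reduced to a function of the total spin of the clique. -/
theorem plantedMean_exp_sub_le (hμ : μ.map (fun x : ℝ => -x) = μ) {k l : ℕ}
    (S' : Finset (Fin n)) (hS : S.card = k) (hS' : S'.card = k) (hl : (S' \ S).card = l)
    (hl1 : 1 ≤ l) {s η : ℝ} (hs : 0 ≤ s) (hs' : s ≤ 1 / 12) (hη : η = l / k) :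
    plantedMean θ μ S (fun σ =>
      Real.exp (s / k * ((∑ i ∈ S', spin σ i) ^ 2 - (∑ i ∈ S, spin σ i) ^ 2))) ≤
    plantedMean θ μ S (fun σ => Real.exp (s * η * (-(2 - η) * ((∑ i ∈ S, spin σ i) ^ 2 / k - 1) +
      1 / k + 18 * s + 12 * s * ((∑ i ∈ S, spin σ i) ^ 2 / k)))) := by
  have hl2 : (S \ S').card = l := by
    rw [← hl]
    exact Finset.card_sdiff_comm (hS.trans hS'.symm)
  have hlk : l ≤ k := by rw [← hl, ← hS']; exact Finset.card_le_card Finset.sdiff_subset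
  have hC : (0 : ℝ) < k.choose l := by exact_mod_cast Nat.choose_pos hlk
  set B := S' \ S with hB
  have hsum : ∀ σ : SpinConfig n, ∑ i ∈ S', spin σ i =
      ∑ i ∈ S, spin σ i - ∑ i ∈ S \ S', spin σ i + ∑ i ∈ B, spin σ i := by
    intro σ
    rw [hB, ← Finset.sum_inter_add_sum_sdiff S S', ← Finset.sum_inter_add_sum_sdiff S' S,
      Finset.inter_comm S' S]
    ring
  set F : SpinConfig n → ℝ := fun σ =>
    Real.exp (s / k * ((∑ i ∈ S', spin σ i) ^ 2 - (∑ i ∈ S, spin σ i) ^ 2)) with hF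
  -- Move `S \ S'` onto `D` by a permutation that fixes every site outside `S`, and flip the sites
  -- outside `S` by `ε`. The mean is unchanged for each pair `(ε, D)`, hence equals its average over
  -- all pairs.
  have key : ∀ ε : SpinConfig n, ∀ D ∈ S.powersetCard l, plantedMean θ μ S F =
      plantedMean θ μ S fun σ => Real.exp (s / k * ((∑ i ∈ S, spin σ i - ∑ i ∈ D, spin σ i +
        ∑ i ∈ B, spin ε i * spin σ i) ^ 2 - (∑ i ∈ S, spin σ i) ^ 2)) := by
    intro ε D hD
    obtain ⟨hDS, hDc⟩ := Finset.mem_powersetCard.1 hD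
    obtain ⟨π, h1, h2, h3⟩ := exists_perm_mapsTo S (A := S \ S') (B := D)
      Finset.sdiff_subset hDS (hl2.trans hDc.symm)
    set e : SpinConfig n := fun i => if i ∈ S then 1 else ε i with he
    rw [← plantedMean_perm θ μ S π h2, ← plantedMean_flip θ μ S hμ e fun i hi => by simp [he, hi]]
    congr 1
    ext σ
    have hes : ∀ i ∈ S, spin (e * σ) i = spin σ i := fun i hi => by simp [spin, he, hi]
    have hπ : ∀ {A A' : Finset (Fin n)}, (∀ i ∈ A, π i ∈ A') → A.card = A'.card →
        ∑ i ∈ A, spin (fun j => (e * σ) (π j)) i = ∑ i ∈ A', spin (e * σ) i :=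
      fun hA hc => sum_perm_eq_of_mapsTo π hA hc fun i => spin (e * σ) i
    have hBS : ∀ i ∈ B, i ∉ S := fun i hi => (Finset.mem_sdiff.1 hi).2
    simp only [hF]
    rw [hsum, hπ h1 (hl2.trans hDc.symm), hπ h2 rfl,
      hπ (A := B) (A' := B) (fun i hi => by rwa [h3 i (hBS i hi)]) rfl,
      Finset.sum_congr rfl hes, Finset.sum_congr rfl fun i hi => hes i (hDS hi)]
    congr 5
    refine Finset.sum_congr rfl fun i hi => ?_
    rw [spin_mul]
    simp [spin, he, hBS i hi]
  have hN : (0 : ℝ) < 2 ^ n * (k.choose l : ℝ) := by positivity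
  refine le_of_mul_le_mul_left ?_ hN
  calc 2 ^ n * (k.choose l : ℝ) * plantedMean θ μ S F
      = ∑ ε : SpinConfig n, ∑ D ∈ S.powersetCard l, plantedMean θ μ S F := by
        simp [hS]
        ring
    _ = ∑ ε : SpinConfig n, ∑ D ∈ S.powersetCard l, plantedMean θ μ S
          fun σ => Real.exp (s / k * ((∑ i ∈ S, spin σ i - ∑ i ∈ D, spin σ i +
          ∑ i ∈ B, spin ε i * spin σ i) ^ 2 - (∑ i ∈ S, spin σ i) ^ 2)) :=
        Finset.sum_congr rfl fun ε _ => Finset.sum_congr rfl fun D hD => key ε D hD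
    _ = plantedMean θ μ S fun σ => ∑ ε : SpinConfig n, ∑ D ∈ S.powersetCard l,
          Real.exp (s / k * ((∑ i ∈ S, spin σ i - ∑ i ∈ D, spin σ i +
          ∑ i ∈ B, spin ε i * spin σ i) ^ 2 - (∑ i ∈ S, spin σ i) ^ 2)) := by
        simp only [sum_plantedMean]
    _ ≤ plantedMean θ μ S fun σ => 2 ^ n * (k.choose l : ℝ) * Real.exp (s * η *
          (-(2 - η) * ((∑ i ∈ S, spin σ i) ^ 2 / k - 1) +
          1 / k + 18 * s + 12 * s * ((∑ i ∈ S, spin σ i) ^ 2 / k))) :=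
        plantedMean_mono θ μ S fun σ =>
          sum_exchange_exp_le σ S B hS hl hl1 hlk hs hs' hη rfl
    _ = _ := by
        simp only [plantedMean, Finset.mul_sum]
        exact Finset.sum_congr rfl fun σ _ => by ring

end

/-! ### Moments of Rademacher sums -/

theorem sum_spinConfig_mul_left {n : ℕ} (e : SpinConfig n) (F : SpinConfig n → ℝ) :
    ∑ σ, F (e * σ) = ∑ σ, F σ :=
  Equiv.sum_comp (Equiv.mulLeft e) F

/-- The configuration equal to `-1` exactly at the site `i`. -/
def spinFlip {n : ℕ} (i : Fin n) : SpinConfig n := Function.update 1 i (-1)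

theorem sum_spin_mul_eq_zero {n : ℕ} (i : Fin n) (F : SpinConfig n → ℝ)
    (hF : ∀ σ, F (spinFlip i * σ) = F σ) : ∑ σ, spin σ i * F σ = 0 := by
  have h := sum_spinConfig_mul_left (spinFlip i) fun σ => spin σ i * F σ
  simp only [hF, spin_mul] at h
  have h2 : spin (spinFlip i) i = -1 := by simp [spin, spinFlip]
  simp only [h2, neg_mul, one_mul, Finset.sum_neg_distrib] at h
  linarith

theorem spin_update_mul_of_ne {n : ℕ} {i j : Fin n} (h : j ≠ i) (σ : SpinConfig n) :
    spin (spinFlip i * σ) j = spin σ j := by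
  simp [spin, spinFlip, h]

theorem sum_spin_mul_spin {n : ℕ} (i j : Fin n) :
    ∑ σ : SpinConfig n, spin σ i * spin σ j = if i = j then 2 ^ n else 0 := by
  split_ifs with h
  · subst h
    have : ∀ σ : SpinConfig n, spin σ i * spin σ i = 1 := fun σ => by rw [← sq, spin_sq]
    simp [this]
  · exact sum_spin_mul_eq_zero i (fun σ => spin σ j)
      fun σ => spin_update_mul_of_ne (Ne.symm h) σ

theorem sum_linear_mul_linear {n : ℕ} (A : Finset (Fin n)) (a b : Fin n → ℝ) :
    ∑ σ : SpinConfig n, (∑ i ∈ A, a i * spin σ i) * (∑ i ∈ A, b i * spin σ i) =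
      2 ^ n * ∑ i ∈ A, a i * b i := by
  simp only [Finset.sum_mul_sum]
  rw [Finset.sum_comm, Finset.mul_sum]
  refine Finset.sum_congr rfl fun i hi => ?_
  rw [Finset.sum_comm]
  have : ∀ j, ∑ σ : SpinConfig n, a i * spin σ i * (b j * spin σ j) =
      if i = j then 2 ^ n * (a i * b j) else 0 := by
    intro j
    have h := sum_spin_mul_spin i j
    have h2 : ∑ σ : SpinConfig n, a i * spin σ i * (b j * spin σ j) =
        (a i * b j) * ∑ σ : SpinConfig n, spin σ i * spin σ j := by
      rw [Finset.mul_sum]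
      exact Finset.sum_congr rfl fun σ _ => by ring
    rw [h2, h]
    split_ifs <;> ring
  simp only [this]
  rw [Finset.sum_ite_eq, if_pos hi]

/-- Fourth mixed moment of two Rademacher sums, the second one twisted by the signs `e`. -/
theorem sum_sq_mul_sq {n : ℕ} (e : SpinConfig n) (A : Finset (Fin n)) :
    ∑ σ : SpinConfig n, (∑ i ∈ A, spin σ i) ^ 2 * (∑ i ∈ A, spin e i * spin σ i) ^ 2 =
      2 ^ n * ((A.card : ℝ) ^ 2 - 2 * A.card + 2 * (∑ i ∈ A, spin e i) ^ 2) := by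
  induction A using Finset.induction_on with
  | empty => simp
  | insert i A hi ih =>
    have hone := sum_linear_mul_linear A (fun _ => (1 : ℝ)) (fun _ => 1)
    have htw := sum_linear_mul_linear A (fun i => spin e i) (fun i => spin e i)
    have hmix := sum_linear_mul_linear A (fun _ => (1 : ℝ)) (fun i => spin e i)
    have hee : ∀ j, spin e j * spin e j = 1 := fun j => by rw [← sq, spin_sq]
    simp only [one_mul, hee, Finset.sum_const, nsmul_eq_mul, mul_one] at hone htw hmix
    set M : SpinConfig n → ℝ := fun σ => ∑ j ∈ A, spin σ j with hM
    set N : SpinConfig n → ℝ := fun σ => ∑ j ∈ A, spin e j * spin σ j with hN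
    have hMi : ∀ σ, M (spinFlip i * σ) = M σ := fun σ =>
      Finset.sum_congr rfl fun j hj => spin_update_mul_of_ne (ne_of_mem_of_not_mem hj hi) σ
    have hNi : ∀ σ, N (spinFlip i * σ) = N σ := fun σ =>
      Finset.sum_congr rfl fun j hj => by
        rw [spin_update_mul_of_ne (ne_of_mem_of_not_mem hj hi) σ]
    -- The part of the expanded product that is odd in the new spin; it sums to zero.
    have hodd := sum_spin_mul_eq_zero i
      (fun σ => 2 * M σ * N σ ^ 2 + 2 * spin e i * M σ ^ 2 * N σ + 2 * M σ + 2 * spin e i * N σ)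
      fun σ => by simp only [hMi, hNi]
    have hexp : ∀ σ : SpinConfig n, (∑ j ∈ insert i A, spin σ j) ^ 2 *
        (∑ j ∈ insert i A, spin e j * spin σ j) ^ 2 =
        M σ ^ 2 * N σ ^ 2 + M σ * M σ + N σ * N σ + 1 + 4 * spin e i * (M σ * N σ) +
          spin σ i * (2 * M σ * N σ ^ 2 + 2 * spin e i * M σ ^ 2 * N σ + 2 * M σ +
            2 * spin e i * N σ) := by
      intro σ
      rw [Finset.sum_insert hi, Finset.sum_insert hi]
      change (spin σ i + M σ) ^ 2 * (spin e i * spin σ i + N σ) ^ 2 = _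
      rcases spin_eq_one_or σ i with h | h <;> rcases spin_eq_one_or e i with h' | h' <;>
        rw [h, h'] <;> ring
    simp only [hexp, Finset.sum_add_distrib, ← Finset.mul_sum]
    rw [hodd, ih, hone, htw, hmix, Finset.card_insert_of_notMem hi, Finset.sum_insert hi]
    have h2 : spin e i ^ 2 = 1 := spin_sq e i
    have h3 : ∑ _σ : SpinConfig n, (1 : ℝ) = 2 ^ n := by simp
    rw [h3]
    push_cast
    linear_combination (-2 * 2 ^ n) * h2

theorem sum_sq_totalSpin {n : ℕ} (A : Finset (Fin n)) :
    ∑ σ : SpinConfig n, (∑ i ∈ A, spin σ i) ^ 2 = 2 ^ n * A.card := by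
  have h := sum_linear_mul_linear A (fun _ => (1 : ℝ)) (fun _ => 1)
  simpa [← sq] using h

theorem sum_pow_four_totalSpin {n : ℕ} (A : Finset (Fin n)) :
    ∑ σ : SpinConfig n, (∑ i ∈ A, spin σ i) ^ 4 =
      2 ^ n * (3 * (A.card : ℝ) ^ 2 - 2 * A.card) := by
  have h := sum_sq_mul_sq (1 : SpinConfig n) A
  have h1 : ∀ i, spin (1 : SpinConfig n) i = 1 := fun i => by simp [spin]
  simp only [h1, one_mul, ← pow_add, Finset.sum_const, nsmul_eq_mul, mul_one] at h
  rw [show (4 : ℕ) = 2 + 2 from rfl, h]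
  ring

/-- A crude bound suffices, as it only controls truncation errors: `y⁶ ≤ 6! exp |y|` for the
normalised sum `y`, and 2880 is `720 · 2 · 2`, with `exp (1/2) ≤ 2`. -/
theorem sum_pow_six_totalSpin_le {n : ℕ} (A : Finset (Fin n)) (hA : 0 < A.card) :
    ∑ σ : SpinConfig n, ((∑ i ∈ A, spin σ i) ^ 2 / A.card) ^ 3 ≤ 2 ^ n * 2880 := by
  have hA' : (0 : ℝ) < A.card := by exact_mod_cast hA
  set c : ℝ := 1 / √A.card with hc
  have hc2 : c ^ 2 * A.card = 1 := by
    rw [hc, div_pow, Real.sq_sqrt hA'.le]; field_simp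
  have hone : ∀ (i : Fin n) (σ : SpinConfig n), spin σ i * spin (1 : SpinConfig n) i = spin σ i :=
    fun i σ => by simp [spin]
  have h1 := sum_spinConfig_exp_le (1 : SpinConfig n) A c
  have h2 := sum_spinConfig_exp_le (1 : SpinConfig n) A (-c)
  simp only [hone, neg_sq, hc2] at h1 h2
  have hexp : Real.exp (1 / 2) ≤ 2 := by
    rw [← Real.le_log_iff_exp_le (by norm_num)]
    linarith [Real.log_two_gt_d9]
  have hpt : ∀ σ : SpinConfig n, ((∑ i ∈ A, spin σ i) ^ 2 / A.card) ^ 3 ≤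
      720 * (Real.exp (c * ∑ i ∈ A, spin σ i) + Real.exp (-c * ∑ i ∈ A, spin σ i)) := by
    intro σ
    set y := c * ∑ i ∈ A, spin σ i with hy
    have e1 : ((∑ i ∈ A, spin σ i) ^ 2 / A.card) = y ^ 2 := by
      rw [hy, mul_pow, div_eq_iff hA'.ne']
      linear_combination (-(∑ i ∈ A, spin σ i) ^ 2) * hc2
    have e2 : (y ^ 2) ^ 3 = |y| ^ 6 := by rw [← sq_abs]; ring
    have e3 := Real.pow_div_factorial_le_exp |y| (abs_nonneg y) 6
    have e4 : Real.exp |y| ≤ Real.exp y + Real.exp (-y) := by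
      rcases abs_cases y with h | h <;> rw [h.1] <;>
        linarith [Real.exp_nonneg y, Real.exp_nonneg (-y)]
    rw [e1, e2, neg_mul, ← hy]
    have e5 : ((Nat.factorial 6 : ℕ) : ℝ) = 720 := by norm_num [Nat.factorial]
    rw [e5, div_le_iff₀ (by norm_num)] at e3
    linarith
  refine (Finset.sum_le_sum fun σ _ => hpt σ).trans ?_
  rw [← Finset.mul_sum, Finset.sum_add_distrib]
  have : (0 : ℝ) < 2 ^ n := by positivity
  nlinarith

/-! ### Association and exponential tilting -/

/-- Chebyshev's sum identity. -/
theorem sum_mul_sum_sub_eq {Ω : Type*} [Fintype Ω] (w a b : Ω → ℝ) :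
    (∑ x, w x * (a x * b x)) * ∑ x, w x - (∑ x, w x * a x) * ∑ x, w x * b x =
      1 / 2 * ∑ x, ∑ y, w x * w y * ((a x - a y) * (b x - b y)) := by
  have h1 : ∑ x, ∑ y, w x * w y * ((a x - a y) * (b x - b y)) =
      ∑ x, ∑ y, (w x * (a x * b x)) * w y + ∑ x, ∑ y, w x * (w y * (a y * b y)) -
      ∑ x, ∑ y, (w x * a x) * (w y * b y) - ∑ x, ∑ y, (w x * b x) * (w y * a y) := by
    simp only [← Finset.sum_add_distrib, ← Finset.sum_sub_distrib]
    exact Finset.sum_congr rfl fun x _ => Finset.sum_congr rfl fun y _ => by ring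
  rw [h1]
  simp only [← Finset.sum_mul_sum]
  ring

/-- Tilting by `exp (t X)` increases the mean of `min X L`,
quantitatively in terms of the variance of `min X L₀`. -/
theorem tilted_min_lower_bound {Ω : Type*} [Fintype Ω] (w X : Ω → ℝ) (hw : ∀ x, 0 ≤ w x)
    (hw1 : ∑ x, w x = 1) (hX : ∀ x, 0 ≤ X x) {t L₀ L : ℝ} (ht : 0 ≤ t) (hL₀ : 0 ≤ L₀)
    (hL : L₀ ≤ L) :
    ∑ x, w x * min (X x) L + t / 2 * Real.exp (-(t * L₀)) *
      ∑ x, ∑ y, w x * w y * (min (X x) L₀ - min (X y) L₀) ^ 2 ≤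
    (∑ x, w x * Real.exp (t * X x) * min (X x) L) / ∑ x, w x * Real.exp (t * X x) := by
  -- Split the tilt as `T * R`, both factors nondecreasing in `X`. Tilting by the bounded `T` gives
  -- the quantitative gain; the further tilt by the unbounded `R` can only raise the mean.
  set T : Ω → ℝ := fun x => Real.exp (t * min (X x) L₀) with hT
  set R : Ω → ℝ := fun x => Real.exp (t * (X x - min (X x) L₀)) with hR
  have hTR : ∀ x, Real.exp (t * X x) = T x * R x := fun x => by
    rw [hT, hR, ← Real.exp_add]; congr 1; ring
  have hwpos : ∀ F : Ω → ℝ, (∀ x, 0 < F x) → 0 < ∑ x, w x * F x := by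
    intro F hF
    refine lt_of_le_of_ne (Finset.sum_nonneg fun x _ => mul_nonneg (hw x) (hF x).le) fun h => ?_
    have h0 := (Finset.sum_eq_zero_iff_of_nonneg
      fun x _ => mul_nonneg (hw x) (hF x).le).1 h.symm
    have : ∑ x, w x = 0 := Finset.sum_eq_zero fun x hx =>
      (mul_eq_zero.1 (h0 x hx)).resolve_right (hF x).ne'
    linarith
  have hZ : 0 < ∑ x, w x * Real.exp (t * X x) := hwpos _ fun x => Real.exp_pos _
  have hZ0 : 0 < ∑ x, w x * T x := hwpos _ fun x => Real.exp_pos _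
  have hmonoT : ∀ x y, t * (min (X x) L₀ - min (X y) L₀) ^ 2 ≤
      (min (X x) L - min (X y) L) * (T x - T y) := by
    have key : ∀ x y, X y ≤ X x → t * (min (X x) L₀ - min (X y) L₀) ^ 2 ≤
        (min (X x) L - min (X y) L) * (T x - T y) := by
      intro x y hxy
      have h0 : 0 ≤ min (X x) L₀ - min (X y) L₀ := sub_nonneg.2 (min_le_min_right _ hxy)
      have h1 : min (X x) L₀ - min (X y) L₀ ≤ min (X x) L - min (X y) L := by
        rcases min_cases (X x) L₀ with ⟨e1, f1⟩ | ⟨e1, f1⟩ <;>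
        rcases min_cases (X y) L₀ with ⟨e2, f2⟩ | ⟨e2, f2⟩ <;>
        rcases min_cases (X x) L with ⟨e3, f3⟩ | ⟨e3, f3⟩ <;>
        rcases min_cases (X y) L with ⟨e4, f4⟩ | ⟨e4, f4⟩ <;> linarith
      have h2 : t * (min (X x) L₀ - min (X y) L₀) ≤ T x - T y := by
        have e1 : T x = T y * Real.exp (t * (min (X x) L₀ - min (X y) L₀)) := by
          simp only [hT]; rw [← Real.exp_add]; congr 1; ring
        have e2 : 1 ≤ T y := Real.one_le_exp (mul_nonneg ht (le_min (hX y) hL₀))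
        have e3 := Real.add_one_le_exp (t * (min (X x) L₀ - min (X y) L₀))
        have e4 : 0 ≤ t * (min (X x) L₀ - min (X y) L₀) := mul_nonneg ht h0
        rw [e1]
        nlinarith
      calc t * (min (X x) L₀ - min (X y) L₀) ^ 2 =
          (min (X x) L₀ - min (X y) L₀) * (t * (min (X x) L₀ - min (X y) L₀)) := by ring
        _ ≤ _ := mul_le_mul h1 h2 (mul_nonneg ht h0) (h0.trans h1)
    intro x y
    rcases le_total (X y) (X x) with h | h
    · exact key x y h
    · have := key y x h
      linarith [this, sq_nonneg (min (X x) L₀ - min (X y) L₀),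
        show (min (X y) L₀ - min (X x) L₀) ^ 2 = (min (X x) L₀ - min (X y) L₀) ^ 2 by ring,
        show (min (X y) L - min (X x) L) * (T y - T x) =
          (min (X x) L - min (X y) L) * (T x - T y) by ring,
        show t * (min (X y) L₀ - min (X x) L₀) ^ 2 = t * (min (X x) L₀ - min (X y) L₀) ^ 2 by ring]
  have hmonoR : ∀ x y, 0 ≤ (min (X x) L - min (X y) L) * (R x - R y) := by
    have hR' : ∀ x y, X y ≤ X x → R y ≤ R x := by
      intro x y hxy
      apply Real.exp_le_exp.2
      apply mul_le_mul_of_nonneg_left _ ht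
      rcases min_cases (X x) L₀ with ⟨e1, f1⟩ | ⟨e1, f1⟩ <;>
      rcases min_cases (X y) L₀ with ⟨e2, f2⟩ | ⟨e2, f2⟩ <;> linarith
    intro x y
    rcases le_total (X y) (X x) with h | h
    · exact mul_nonneg (sub_nonneg.2 (min_le_min_right L h)) (sub_nonneg.2 (hR' x y h))
    · exact mul_nonneg_of_nonpos_of_nonpos (sub_nonpos.2 (min_le_min_right L h))
        (sub_nonpos.2 (hR' y x h))
  have c1 := sum_mul_sum_sub_eq (fun x => w x * T x) (fun x => min (X x) L) R
  have c2 := sum_mul_sum_sub_eq w (fun x => min (X x) L) T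
  set V := ∑ x, ∑ y, w x * w y * (min (X x) L₀ - min (X y) L₀) ^ 2 with hV
  have hV0 : 0 ≤ V := Finset.sum_nonneg fun x _ => Finset.sum_nonneg fun y _ =>
    mul_nonneg (mul_nonneg (hw x) (hw y)) (sq_nonneg _)
  have d1 : 0 ≤ ∑ x, ∑ y, w x * T x * (w y * T y) *
      ((min (X x) L - min (X y) L) * (R x - R y)) :=
    Finset.sum_nonneg fun x _ => Finset.sum_nonneg fun y _ =>
      mul_nonneg (mul_nonneg (mul_nonneg (hw x) (Real.exp_nonneg _))
        (mul_nonneg (hw y) (Real.exp_nonneg _))) (hmonoR x y)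
  have d2 : t * V ≤ ∑ x, ∑ y, w x * w y * ((min (X x) L - min (X y) L) * (T x - T y)) := by
    rw [hV, Finset.mul_sum]
    refine Finset.sum_le_sum fun x _ => ?_
    rw [Finset.mul_sum]
    refine Finset.sum_le_sum fun y _ => ?_
    calc _ = w x * w y * (t * (min (X x) L₀ - min (X y) L₀) ^ 2) := by ring
      _ ≤ _ := mul_le_mul_of_nonneg_left (hmonoT x y) (mul_nonneg (hw x) (hw y))
  have hZ0le : ∑ x, w x * T x ≤ Real.exp (t * L₀) := by
    calc ∑ x, w x * T x ≤ ∑ x, w x * Real.exp (t * L₀) :=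
          Finset.sum_le_sum fun x _ => mul_le_mul_of_nonneg_left
            (Real.exp_le_exp.2 (mul_le_mul_of_nonneg_left (min_le_right _ _) ht)) (hw x)
      _ = _ := by rw [← Finset.sum_mul, hw1, one_mul]
  have step1 : (∑ x, w x * T x * min (X x) L) / ∑ x, w x * T x ≤
      (∑ x, w x * Real.exp (t * X x) * min (X x) L) / ∑ x, w x * Real.exp (t * X x) := by
    rw [div_le_div_iff₀ hZ0 hZ]
    have e1 : ∑ x, w x * Real.exp (t * X x) = ∑ x, w x * T x * R x :=
      Finset.sum_congr rfl fun x _ => by rw [hTR]; ring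
    have e2 : ∑ x, w x * Real.exp (t * X x) * min (X x) L =
        ∑ x, w x * T x * (min (X x) L * R x) :=
      Finset.sum_congr rfl fun x _ => by rw [hTR]; ring
    rw [e1, e2]
    linarith
  refine le_trans ?_ step1
  rw [le_div_iff₀ hZ0]
  have e3 : ∑ x, w x * T x * min (X x) L = ∑ x, w x * (min (X x) L * T x) :=
    Finset.sum_congr rfl fun x _ => by ring
  rw [e3]
  rw [hw1] at c2
  have e4 : t / 2 * Real.exp (-(t * L₀)) * V * ∑ x, w x * T x ≤ t / 2 * V := by
    have : Real.exp (-(t * L₀)) * ∑ x, w x * T x ≤ 1 := by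
      rw [Real.exp_neg, inv_mul_le_iff₀ (Real.exp_pos _), mul_one]
      exact hZ0le
    calc _ = (t / 2 * V) * (Real.exp (-(t * L₀)) * ∑ x, w x * T x) := by ring
      _ ≤ (t / 2 * V) * 1 := mul_le_mul_of_nonneg_left this (by positivity)
      _ = _ := mul_one _
  rw [add_mul]
  linarith

/-! ### Independent spins in a random field, and two replicas -/

noncomputable section

/-- Law of independent spins in the field `h`. -/
def fieldWeight {n : ℕ} (h : Fin n → ℝ) (σ : SpinConfig n) : ℝ :=
  ∏ i, (1 + spin σ i * Real.tanh (h i)) / 2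

theorem fieldWeight_nonneg {n : ℕ} (h : Fin n → ℝ) (σ : SpinConfig n) : 0 ≤ fieldWeight h σ := by
  refine Finset.prod_nonneg fun i _ => ?_
  have h1 := Real.tanh_lt_one (h i)
  have h2 := Real.neg_one_lt_tanh (h i)
  rcases spin_eq_one_or σ i with e | e <;> rw [e] <;> linarith

theorem sum_fieldWeight {n : ℕ} (h : Fin n → ℝ) : ∑ σ, fieldWeight h σ = 1 := by
  have := sum_spinConfig_prod fun i (u : ℤˣ) => (1 + ((u : ℤ) : ℝ) * Real.tanh (h i)) / 2
  refine Eq.trans this (Finset.prod_eq_one fun i _ => ?_)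
  push_cast
  ring

theorem continuous_fieldWeight {n : ℕ} (σ : SpinConfig n) :
    Continuous fun h : Fin n → ℝ => fieldWeight h σ := by
  have : Continuous Real.tanh := by
    have h : Real.tanh = fun x => Real.sinh x / Real.cosh x := funext Real.tanh_eq_sinh_div_cosh
    rw [h]
    exact Real.continuous_sinh.div Real.continuous_cosh fun x => (Real.cosh_pos x).ne'
  unfold fieldWeight
  fun_prop

theorem fieldWeight_le_one {n : ℕ} (h : Fin n → ℝ) (σ : SpinConfig n) : fieldWeight h σ ≤ 1 := by
  rw [← sum_fieldWeight h]
  exact Finset.single_le_sum (fun τ _ => fieldWeight_nonneg h τ) (Finset.mem_univ σ)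

/-- The factor `∏ 2 cosh (h i)` normalises the field part and cancels in the quotient. -/
theorem gibbsProb_eq_tilted {n : ℕ} (θ : ℝ) (S : Finset (Fin n)) (h : Fin n → ℝ)
    (σ : SpinConfig n) :
    gibbsProb θ S h σ =
      fieldWeight h σ * Real.exp (θ / 2 * ((∑ i ∈ S, spin σ i) ^ 2 / S.card)) /
      ∑ τ, fieldWeight h τ * Real.exp (θ / 2 * ((∑ i ∈ S, spin τ i) ^ 2 / S.card)) := by
  have hw : ∀ τ : SpinConfig n, gibbsWeight θ S h τ = (∏ i, 2 * Real.cosh (h i)) *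
      (fieldWeight h τ * Real.exp (θ / 2 * ((∑ i ∈ S, spin τ i) ^ 2 / S.card))) := by
    intro τ
    rw [gibbsWeight, Real.exp_add, Real.exp_sum, ← mul_assoc, mul_comm, fieldWeight,
      ← Finset.prod_mul_distrib]
    congr 1
    · refine Finset.prod_congr rfl fun i _ => ?_
      have hc := (Real.cosh_pos (h i)).ne'
      rw [Real.tanh_eq_sinh_div_cosh]
      rcases spin_eq_one_or τ i with e | e <;> rw [e] <;> field_simp
      · rw [← Real.cosh_add_sinh]
      · rw [← Real.cosh_sub_sinh]; ring
    · congr 1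
      rw [← div_div]
      ring
  have hP : (∏ i, 2 * Real.cosh (h i)) ≠ 0 :=
    Finset.prod_ne_zero_iff.2 fun i _ => by have := Real.cosh_pos (h i); positivity
  rw [gibbsProb, hw]
  simp only [hw]
  rw [← Finset.mul_sum, mul_div_mul_left _ _ hP]

theorem measurable_tanh : Measurable Real.tanh := by
  have h : Real.tanh = fun x => Real.sinh x / Real.cosh x := funext Real.tanh_eq_sinh_div_cosh
  rw [h]
  exact Real.measurable_sinh.div Real.measurable_cosh

variable (μ : Measure ℝ)

theorem integral_tanh_eq_zero (hμ : μ.map (fun x : ℝ => -x) = μ) :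
    ∫ x, Real.tanh x ∂μ = 0 := by
  have h : ∫ x, Real.tanh x ∂μ = ∫ x, Real.tanh (-x) ∂μ := by
    conv_lhs => rw [← hμ]
    exact integral_map measurable_neg.aemeasurable measurable_tanh.aestronglyMeasurable
  simp only [Real.tanh_neg, integral_neg] at h
  linarith

theorem integral_tanh_sq_nonneg : 0 ≤ ∫ x, Real.tanh x ^ 2 ∂μ :=
  integral_nonneg fun _ => sq_nonneg _

variable [IsProbabilityMeasure μ]

theorem abs_tanh_le_one (x : ℝ) : |Real.tanh x| ≤ 1 :=
  abs_le.2 ⟨(Real.neg_one_lt_tanh x).le, (Real.tanh_lt_one x).le⟩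

theorem integrable_tanh : Integrable Real.tanh μ :=
  Integrable.of_bound measurable_tanh.aestronglyMeasurable 1
    (Filter.Eventually.of_forall abs_tanh_le_one)

theorem integrable_tanh_sq : Integrable (fun x => Real.tanh x ^ 2) μ :=
  Integrable.of_bound (measurable_tanh.pow_const 2).aestronglyMeasurable 1
    (Filter.Eventually.of_forall fun x => by
      rw [Real.norm_eq_abs, abs_pow]
      exact pow_le_one₀ (abs_nonneg _) (abs_tanh_le_one x))

/-- The nondegeneracy behind the signal: the overlap of two replicas in the same field does not
concentrate at 1, so the variance of `X` given the field survives. -/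
theorem integral_tanh_sq_lt_one : ∫ x, Real.tanh x ^ 2 ∂μ < 1 := by
  have hpos : ∀ x, 0 < 1 - Real.tanh x ^ 2 := fun x => by
    have h1 := Real.tanh_lt_one x
    have h2 := Real.neg_one_lt_tanh x
    nlinarith
  have hint : Integrable (fun x => 1 - Real.tanh x ^ 2) μ :=
    (integrable_const 1).sub (integrable_tanh_sq μ)
  have h : 0 < ∫ x, (1 - Real.tanh x ^ 2) ∂μ := by
    rw [integral_pos_iff_support_of_nonneg (fun x => (hpos x).le) hint]
    have : Function.support (fun x => 1 - Real.tanh x ^ 2) = Set.univ :=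
      Set.eq_univ_of_forall fun x => (hpos x).ne'
    rw [this]
    simp
  rw [integral_sub (integrable_const 1) (integrable_tanh_sq μ)] at h
  simp at h
  linarith

theorem integrable_fieldWeight {n : ℕ} (σ : SpinConfig n) :
    Integrable (fun h : Fin n → ℝ => fieldWeight h σ) (Measure.pi fun _ => μ) :=
  Integrable.of_bound (continuous_fieldWeight σ).aestronglyMeasurable 1
    (Filter.Eventually.of_forall fun h => by
      rw [Real.norm_of_nonneg (fieldWeight_nonneg h σ)]
      exact fieldWeight_le_one h σ)

theorem integrable_fieldWeight_mul {n : ℕ} (σ τ : SpinConfig n) :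
    Integrable (fun h : Fin n → ℝ => fieldWeight h σ * fieldWeight h τ)
      (Measure.pi fun _ => μ) :=
  Integrable.of_bound
    ((continuous_fieldWeight σ).mul (continuous_fieldWeight τ)).aestronglyMeasurable 1
    (Filter.Eventually.of_forall fun h => by
      rw [Real.norm_of_nonneg (mul_nonneg (fieldWeight_nonneg h σ) (fieldWeight_nonneg h τ))]
      exact mul_le_one₀ (fieldWeight_le_one h σ) (fieldWeight_nonneg h τ) (fieldWeight_le_one h τ))

theorem integral_fieldWeight (hμ : μ.map (fun x : ℝ => -x) = μ) {n : ℕ} (σ : SpinConfig n) :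
    ∫ h, fieldWeight h σ ∂(Measure.pi fun _ : Fin n => μ) = (1 / 2) ^ n := by
  unfold fieldWeight
  rw [integral_fintype_prod_eq_prod fun i x => (1 + spin σ i * Real.tanh x) / 2]
  have : ∀ i, ∫ x, (1 + spin σ i * Real.tanh x) / 2 ∂μ = 1 / 2 := by
    intro i
    rw [integral_div, integral_add (integrable_const _) ((integrable_tanh μ).const_mul _),
      integral_const_mul, integral_tanh_eq_zero μ hμ]
    simp
  simp [this]

/-- The terms linear in `tanh` vanish by symmetry, so the joint law depends only on the sitewise
products of the two replicas. -/
theorem integral_fieldWeight_mul (hμ : μ.map (fun x : ℝ => -x) = μ) {n : ℕ}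
    (σ τ : SpinConfig n) :
    ∫ h, fieldWeight h σ * fieldWeight h τ ∂(Measure.pi fun _ : Fin n => μ) =
      ∏ i, (1 + (∫ x, Real.tanh x ^ 2 ∂μ) * (spin σ i * spin τ i)) / 4 := by
  unfold fieldWeight
  simp only [← Finset.prod_mul_distrib]
  rw [integral_fintype_prod_eq_prod fun i x =>
    (1 + spin σ i * Real.tanh x) / 2 * ((1 + spin τ i * Real.tanh x) / 2)]
  refine Finset.prod_congr rfl fun i _ => ?_
  have h1 : ∀ x, (1 + spin σ i * Real.tanh x) / 2 * ((1 + spin τ i * Real.tanh x) / 2) =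
      (1 + (spin σ i + spin τ i) * Real.tanh x + (spin σ i * spin τ i) * Real.tanh x ^ 2) / 4 :=
    fun x => by ring
  simp only [h1]
  have i1 := (integrable_tanh μ).const_mul (spin σ i + spin τ i)
  have i2 := (integrable_tanh_sq μ).const_mul (spin σ i * spin τ i)
  have i0 : Integrable (fun x => 1 + (spin σ i + spin τ i) * Real.tanh x) μ :=
    (integrable_const _).add i1
  rw [integral_div, integral_add i0 i2,
    integral_add (integrable_const _) i1, integral_const_mul, integral_const_mul,
    integral_tanh_eq_zero μ hμ]
  simp
  ring

/-- Correlations of the overlap variables of two replicas in the same field. -/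
theorem sum_overlap_weight {n : ℕ} (τ : ℝ) (i j : Fin n) :
    ∑ e : SpinConfig n, (∏ r, (1 + τ * spin e r) / 4) * (spin e i * spin e j) =
      (1 / 2) ^ n * if i = j then 1 else τ ^ 2 := by
  have hlin : ∀ A : Finset (Fin n), ∑ e : SpinConfig n, (∏ r, (1 + τ * spin e r) / 4) *
      ∏ r ∈ A, spin e r = (1 / 2) ^ n * τ ^ A.card := by
    intro A
    have h1 : ∀ e : SpinConfig n, (∏ r, (1 + τ * spin e r) / 4) * ∏ r ∈ A, spin e r =
        ∏ r, (1 + τ * ((e r : ℤ) : ℝ)) / 4 * (if r ∈ A then ((e r : ℤ) : ℝ) else 1) := by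
      intro e
      rw [Finset.prod_mul_distrib, Finset.prod_ite_mem, Finset.univ_inter]
      rfl
    simp only [h1]
    rw [sum_spinConfig_prod fun r (u : ℤˣ) =>
      (1 + τ * ((u : ℤ) : ℝ)) / 4 * (if r ∈ A then ((u : ℤ) : ℝ) else 1)]
    have h2 : ∀ r, (1 + τ * (((1 : ℤˣ) : ℤ) : ℝ)) / 4 *
        (if r ∈ A then (((1 : ℤˣ) : ℤ) : ℝ) else 1) + (1 + τ * (((-1 : ℤˣ) : ℤ) : ℝ)) / 4 *
        (if r ∈ A then (((-1 : ℤˣ) : ℤ) : ℝ) else 1) = 1 / 2 * (if r ∈ A then τ else 1) := by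
      intro r
      split_ifs <;> push_cast <;> ring
    simp only [h2]
    rw [Finset.prod_mul_distrib, Finset.prod_ite_mem]
    simp
  split_ifs with h
  · subst h
    have := hlin ∅
    simp only [Finset.prod_empty, Finset.card_empty, pow_zero] at this
    rw [← this]
    refine Finset.sum_congr rfl fun e _ => ?_
    rw [← sq, spin_sq]
  · have := hlin {i, j}
    rw [Finset.card_pair h] at this
    rw [← this]
    refine Finset.sum_congr rfl fun e _ => ?_
    rw [Finset.prod_pair h]

theorem sum_overlap_weight_sq {n : ℕ} (τ : ℝ) (A : Finset (Fin n)) :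
    ∑ e : SpinConfig n, (∏ r, (1 + τ * spin e r) / 4) * (∑ i ∈ A, spin e i) ^ 2 =
      (1 / 2) ^ n * (A.card + A.card * (A.card - 1) * τ ^ 2) := by
  have h1 : ∀ e : SpinConfig n, (∏ r, (1 + τ * spin e r) / 4) * (∑ i ∈ A, spin e i) ^ 2 =
      ∑ i ∈ A, ∑ j ∈ A, (∏ r, (1 + τ * spin e r) / 4) * (spin e i * spin e j) := by
    intro e
    rw [sq, Finset.sum_mul_sum, Finset.mul_sum]
    exact Finset.sum_congr rfl fun i _ => by rw [Finset.mul_sum]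
  simp only [h1]
  rw [Finset.sum_comm]
  have h2 : ∀ i ∈ A, ∑ e : SpinConfig n, ∑ j ∈ A,
      (∏ r, (1 + τ * spin e r) / 4) * (spin e i * spin e j) =
      (1 / 2) ^ n * (1 - τ ^ 2 + A.card * τ ^ 2) := by
    intro i hi
    rw [Finset.sum_comm]
    simp only [sum_overlap_weight]
    rw [← Finset.mul_sum]
    congr 1
    have : ∀ j, (if i = j then (1 : ℝ) else τ ^ 2) = (if i = j then 1 - τ ^ 2 else 0) + τ ^ 2 := by
      intro j; split_ifs <;> ring
    simp only [this]
    rw [Finset.sum_add_distrib, Finset.sum_ite_eq, if_pos hi]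
    simp
  rw [Finset.sum_congr rfl h2]
  simp
  ring

theorem sum_overlap_weight_one {n : ℕ} (τ : ℝ) :
    ∑ e : SpinConfig n, ∏ r, (1 + τ * spin e r) / 4 = (1 / 2) ^ n := by
  have := sum_spinConfig_prod fun (r : Fin n) (u : ℤˣ) => (1 + τ * ((u : ℤ) : ℝ)) / 4
  refine Eq.trans this ?_
  rw [Finset.prod_congr rfl fun r _ => show (1 + τ * (((1 : ℤˣ) : ℤ) : ℝ)) / 4 +
    (1 + τ * (((-1 : ℤˣ) : ℤ) : ℝ)) / 4 = 1 / 2 by push_cast; ring]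
  simp

/-- Lower bound for the truncated variance of the normalised squared spin,
for two Rademacher replicas related by the signs `e`. -/
theorem sum_min_sub_min_sq_ge {n : ℕ} (e : SpinConfig n) (S : Finset (Fin n)) (hS : 0 < S.card)
    {L : ℝ} (hL : 0 < L) :
    2 ^ n * (2 * (1 - ((∑ i ∈ S, spin e i) / S.card) ^ 2) - 11520 / L) ≤
      ∑ σ : SpinConfig n, (min ((∑ i ∈ S, spin σ i) ^ 2 / S.card) L -
        min ((∑ i ∈ S, spin (e * σ) i) ^ 2 / S.card) L) ^ 2 := by
  have hk : (0 : ℝ) < S.card := by exact_mod_cast hS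
  set k := (S.card : ℝ) with hkdef
  set X : SpinConfig n → ℝ := fun σ => (∑ i ∈ S, spin σ i) ^ 2 / k with hX
  have hX0 : ∀ σ, 0 ≤ X σ := fun σ => by positivity
  -- Truncation costs at most third moments, through `(x - min x L)² ≤ x³ / L`. The two sixth-moment
  -- bounds then give `11520 = 2 · 2 · 2880`.
  have hpt : ∀ x y : ℝ, 0 ≤ x → 0 ≤ y → 1 / 2 * (x - y) ^ 2 - 2 * (x ^ 3 / L) - 2 * (y ^ 3 / L) ≤
      (min x L - min y L) ^ 2 := by
    have hr : ∀ x : ℝ, 0 ≤ x → (x - min x L) ^ 2 ≤ x ^ 3 / L := by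
      intro x hx
      rw [le_div_iff₀ hL]
      rcases min_cases x L with ⟨h1, h2⟩ | ⟨h1, h2⟩ <;> rw [h1]
      · have : 0 ≤ x ^ 3 := by positivity
        simpa using this
      · have e1 : (x - L) ^ 2 ≤ x ^ 2 := by nlinarith
        calc (x - L) ^ 2 * L ≤ x ^ 2 * x := mul_le_mul e1 h2.le hL.le (sq_nonneg _)
          _ = _ := by ring
    intro x y hx hy
    have h1 := hr x hx
    have h2 := hr y hy
    nlinarith [sq_nonneg ((min x L - min y L) - ((x - min x L) - (y - min y L))),
      sq_nonneg ((x - min x L) + (y - min y L))]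
  have m4 : ∑ σ, X σ ^ 2 = 2 ^ n * (3 - 2 / k) := by
    have := sum_pow_four_totalSpin S
    have h2 : ∀ σ, X σ ^ 2 = (∑ i ∈ S, spin σ i) ^ 4 / k ^ 2 := fun σ => by
      simp only [hX]; rw [div_pow]; ring
    simp only [h2]
    rw [← Finset.sum_div, this, ← hkdef]
    field_simp
  have m4' : ∑ σ, X (e * σ) ^ 2 = 2 ^ n * (3 - 2 / k) := by
    rw [← m4]; exact sum_spinConfig_mul_left e fun σ => X σ ^ 2
  have m6 : ∑ σ, X σ ^ 3 ≤ 2 ^ n * 2880 := sum_pow_six_totalSpin_le S hS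
  have m6' : ∑ σ, X (e * σ) ^ 3 ≤ 2 ^ n * 2880 := by
    rw [sum_spinConfig_mul_left e fun σ => X σ ^ 3]; exact m6
  have mx : ∑ σ, X σ * X (e * σ) =
      2 ^ n * (1 - 2 / k + 2 * ((∑ i ∈ S, spin e i) / k) ^ 2) := by
    have := sum_sq_mul_sq e S
    have h2 : ∀ σ, X σ * X (e * σ) =
        ((∑ i ∈ S, spin σ i) ^ 2 * (∑ i ∈ S, spin e i * spin σ i) ^ 2) / k ^ 2 := fun σ => by
      simp only [hX, spin_mul]; field_simp
    simp only [h2]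
    rw [← Finset.sum_div, this, ← hkdef]
    field_simp
  calc _ ≤ ∑ σ, (1 / 2 * (X σ - X (e * σ)) ^ 2 - 2 * (X σ ^ 3 / L) -
        2 * (X (e * σ) ^ 3 / L)) := by
        have hexp : ∀ σ, 1 / 2 * (X σ - X (e * σ)) ^ 2 - 2 * (X σ ^ 3 / L) -
            2 * (X (e * σ) ^ 3 / L) = 1 / 2 * X σ ^ 2 + 1 / 2 * X (e * σ) ^ 2 -
            X σ * X (e * σ) - 2 / L * X σ ^ 3 - 2 / L * X (e * σ) ^ 3 := fun σ => by ring
        simp only [hexp, Finset.sum_sub_distrib, Finset.sum_add_distrib, ← Finset.mul_sum]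
        rw [m4, m4', mx]
        have h1 := mul_le_mul_of_nonneg_left m6 (show 0 ≤ 2 / L by positivity)
        have h2 := mul_le_mul_of_nonneg_left m6' (show 0 ≤ 2 / L by positivity)
        have h3 : (2 : ℝ) ^ n * (11520 / L) = 2 * (2 / L * (2 ^ n * 2880)) := by ring
        linarith
    _ ≤ _ := Finset.sum_le_sum fun σ _ => hpt _ _ (hX0 _) (hX0 _)

/-- The truncated second moment of the clique magnetisation exceeds its value for
independent spins by a constant. -/
theorem exists_plantedMean_min_ge (hμ : μ.map (fun x : ℝ => -x) = μ) {θ : ℝ} (hθ : 0 < θ) :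
    ∃ c L : ℝ, 0 < c ∧ 1 ≤ L ∧ ∀ (n : ℕ) (S : Finset (Fin n)), 2 ≤ S.card →
      1 + c ≤ plantedMean θ μ S fun σ => min ((∑ i ∈ S, spin σ i) ^ 2 / S.card) L := by
  set τ := ∫ x, Real.tanh x ^ 2 ∂μ with hτ
  have hτ1 : τ < 1 := integral_tanh_sq_lt_one μ
  have hτ0 : 0 ≤ τ := integral_tanh_sq_nonneg μ
  have hv : 0 < 1 - τ ^ 2 := by nlinarith
  -- Two truncation levels are needed. `L₀` makes the variance error `11520 / L₀` equal to `(1 - τ²)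
  -- / 2` and fixes the gain factor `κ`, which is exponentially small in `L₀`. Then `L` is taken so
  -- large that the truncation loss `3 / L` is at most half of the gain `κ (1 - τ²) / 2`.
  set L₀ := 23040 / (1 - τ ^ 2) with hL₀
  have hL₀pos : 0 < L₀ := by positivity
  set κ := θ / 2 / 2 * Real.exp (-(θ / 2 * L₀)) with hκ
  have hκpos : 0 < κ := by positivity
  set L := max (max L₀ 1) (12 / (κ * (1 - τ ^ 2))) with hL
  have hLL₀ : L₀ ≤ L := (le_max_left _ _).trans (le_max_left _ _)
  have hL1 : 1 ≤ L := (le_max_right _ _).trans (le_max_left _ _)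
  have hLpos : 0 < L := by linarith
  have hL3 : 3 / L ≤ κ * (1 - τ ^ 2) / 4 := by
    have : 12 / (κ * (1 - τ ^ 2)) ≤ L := le_max_right _ _
    rw [div_le_iff₀ (by positivity)] at this
    rw [div_le_iff₀ hLpos]
    linarith
  refine ⟨κ * (1 - τ ^ 2) / 4, L, by positivity, hL1, fun n S hS => ?_⟩
  have hk2 : (2 : ℝ) ≤ S.card := by exact_mod_cast hS
  have hk0 : (0 : ℝ) < S.card := by linarith
  set X : SpinConfig n → ℝ := fun σ => (∑ i ∈ S, spin σ i) ^ 2 / S.card with hX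
  have hX0 : ∀ σ, 0 ≤ X σ := fun σ => by positivity
  have h2n : (0 : ℝ) < (1 / 2) ^ n := by positivity
  have h2n' : ((1 : ℝ) / 2) ^ n * 2 ^ n = 1 := by rw [← mul_pow]; norm_num
  have hrep : 1 / 2 * (1 - τ ^ 2) ≤ ∑ σ : SpinConfig n, ∑ ρ : SpinConfig n,
      (∏ i, (1 + τ * (spin σ i * spin ρ i)) / 4) * (min (X σ) L₀ - min (X ρ) L₀) ^ 2 := by
    -- Substitute `ρ = e * σ`: the weight depends on the overlap signs `e` alone, and `σ` becomes
    -- uniform given `e`.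
    have e1 : ∑ σ : SpinConfig n, ∑ ρ : SpinConfig n,
        (∏ i, (1 + τ * (spin σ i * spin ρ i)) / 4) * (min (X σ) L₀ - min (X ρ) L₀) ^ 2 =
        ∑ e : SpinConfig n, (∏ i, (1 + τ * spin e i) / 4) *
          ∑ σ, (min (X σ) L₀ - min (X (e * σ)) L₀) ^ 2 := by
      simp only [Finset.mul_sum]
      rw [Finset.sum_comm (γ := SpinConfig n) (s := Finset.univ) (t := Finset.univ)
        (f := fun e σ => (∏ i, (1 + τ * spin e i) / 4) *
          (min (X σ) L₀ - min (X (e * σ)) L₀) ^ 2)]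
      refine Finset.sum_congr rfl fun σ _ => ?_
      rw [← Equiv.sum_comp (Equiv.mulRight σ)]
      refine Finset.sum_congr rfl fun e _ => ?_
      rw [Equiv.coe_mulRight]
      congr 1
      refine Finset.prod_congr rfl fun i _ => ?_
      rw [spin_mul]
      congr 3
      linear_combination (spin e i) * spin_sq σ i
    rw [e1]
    have hω : ∀ e : SpinConfig n, 0 ≤ ∏ i, (1 + τ * spin e i) / 4 := fun e =>
      Finset.prod_nonneg fun i _ => by
        rcases spin_eq_one_or e i with h | h <;> rw [h] <;> linarith
    refine le_trans ?_ (Finset.sum_le_sum fun e _ => mul_le_mul_of_nonneg_left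
      (sum_min_sub_min_sq_ge e S (by omega) hL₀pos) (hω e))
    have e2 : ∀ e : SpinConfig n, (∏ i, (1 + τ * spin e i) / 4) *
        (2 ^ n * (2 * (1 - ((∑ i ∈ S, spin e i) / S.card) ^ 2) - 11520 / L₀)) =
        2 ^ n * (2 - 11520 / L₀) * (∏ i, (1 + τ * spin e i) / 4) -
        2 ^ n * (2 / (S.card : ℝ) ^ 2) *
          ((∏ i, (1 + τ * spin e i) / 4) * (∑ i ∈ S, spin e i) ^ 2) := fun e => by
      rw [div_pow]; ring
    simp only [e2]
    rw [Finset.sum_sub_distrib, ← Finset.mul_sum, ← Finset.mul_sum, sum_overlap_weight_one,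
      sum_overlap_weight_sq]
    have e3 : (11520 : ℝ) / L₀ = (1 - τ ^ 2) / 2 := by rw [hL₀]; field_simp; norm_num
    have e4 : (2 : ℝ) ^ n * (2 - 11520 / L₀) * (1 / 2) ^ n - 2 ^ n * (2 / (S.card : ℝ) ^ 2) *
        ((1 / 2) ^ n * (S.card + S.card * (S.card - 1) * τ ^ 2)) =
        2 * (1 - 1 / S.card) * (1 - τ ^ 2) - (1 - τ ^ 2) / 2 := by
      rw [e3]
      have : (2 / (S.card : ℝ) ^ 2) * (S.card + S.card * (S.card - 1) * τ ^ 2) =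
        2 / S.card + 2 * (1 - 1 / S.card) * τ ^ 2 := by field_simp
      have h3 : (2 : ℝ) ^ n * (2 - (1 - τ ^ 2) / 2) * (1 / 2) ^ n -
        2 ^ n * (2 / (S.card : ℝ) ^ 2) *
        ((1 / 2) ^ n * (S.card + S.card * (S.card - 1) * τ ^ 2)) =
        ((1 / 2) ^ n * 2 ^ n) * ((2 - (1 - τ ^ 2) / 2) - (2 / (S.card : ℝ) ^ 2) *
          (S.card + S.card * (S.card - 1) * τ ^ 2)) := by ring
      rw [h3, h2n', this]
      ring
    rw [e4]
    have : 1 / (S.card : ℝ) ≤ 1 / 2 := one_div_le_one_div_of_le (by norm_num) hk2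
    nlinarith
  have hpt : ∀ h : Fin n → ℝ,
      ∑ σ, fieldWeight h σ * min (X σ) L + κ * ∑ σ, ∑ ρ, fieldWeight h σ * fieldWeight h ρ *
        (min (X σ) L₀ - min (X ρ) L₀) ^ 2 ≤ ∑ σ, gibbsProb θ S h σ * min (X σ) L := by
    intro h
    refine (tilted_min_lower_bound (fieldWeight h) X (fieldWeight_nonneg h) (sum_fieldWeight h)
      hX0 (by positivity) hL₀pos.le hLL₀).trans_eq ?_
    rw [Finset.sum_div]
    refine Finset.sum_congr rfl fun σ _ => ?_
    rw [gibbsProb_eq_tilted]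
    ring
  have hunif : 1 - 3 / L ≤ (1 / 2) ^ n * ∑ σ, min (X σ) L := by
    have h1 : ∀ x : ℝ, 0 ≤ x → x - x ^ 2 / L ≤ min x L := by
      intro x hx
      rcases min_cases x L with ⟨h1, _⟩ | ⟨h1, _⟩ <;> rw [h1]
      · have : 0 ≤ x ^ 2 / L := by positivity
        linarith
      · rw [sub_le_iff_le_add, ← sub_le_iff_le_add', le_div_iff₀ hLpos]
        nlinarith [sq_nonneg (x - L)]
    have h2 : ∑ σ, (X σ - X σ ^ 2 / L) ≤ ∑ σ, min (X σ) L :=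
      Finset.sum_le_sum fun σ _ => h1 _ (hX0 σ)
    have h3 : ∑ σ, X σ = 2 ^ n := by
      simp only [hX]
      rw [← Finset.sum_div, sum_sq_totalSpin]
      field_simp
    have h4 : ∑ σ, X σ ^ 2 ≤ 2 ^ n * 3 := by
      have h5 : ∀ σ, X σ ^ 2 = (∑ i ∈ S, spin σ i) ^ 4 / (S.card : ℝ) ^ 2 := fun σ => by
        simp only [hX]; rw [div_pow]; ring
      simp only [h5]
      rw [← Finset.sum_div, sum_pow_four_totalSpin, div_le_iff₀ (by positivity), mul_assoc]
      gcongr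
      linarith
    rw [Finset.sum_sub_distrib, h3, ← Finset.sum_div] at h2
    have h6 : (2 : ℝ) ^ n - 2 ^ n * 3 / L ≤ ∑ σ, min (X σ) L := by
      refine le_trans ?_ h2
      gcongr
    calc 1 - 3 / L = (1 / 2) ^ n * 2 ^ n * (1 - 3 / L) := by rw [h2n', one_mul]
      _ = (1 / 2) ^ n * (2 ^ n - 2 ^ n * 3 / L) := by ring
      _ ≤ _ := mul_le_mul_of_nonneg_left h6 h2n.le
  have hi1 : Integrable (fun h : Fin n → ℝ => ∑ σ, fieldWeight h σ * min (X σ) L)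
      (Measure.pi fun _ => μ) :=
    integrable_finsetSum _ fun σ _ => (integrable_fieldWeight μ σ).mul_const _
  have hi2 : Integrable (fun h : Fin n → ℝ => κ * ∑ σ, ∑ ρ, fieldWeight h σ * fieldWeight h ρ *
      (min (X σ) L₀ - min (X ρ) L₀) ^ 2) (Measure.pi fun _ => μ) :=
    (integrable_finsetSum _ fun σ _ => integrable_finsetSum _ fun ρ _ =>
      (integrable_fieldWeight_mul μ σ ρ).mul_const _).const_mul _
  have hi3 : Integrable (fun h : Fin n → ℝ => ∑ σ, gibbsProb θ S h σ * min (X σ) L)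
      (Measure.pi fun _ => μ) :=
    integrable_finsetSum _ fun σ _ => (integrable_gibbsProb θ μ S σ).mul_const _
  rw [plantedMean_eq_integral]
  refine le_trans ?_ (integral_mono (hi1.add hi2) hi3 hpt)
  rw [integral_add' hi1 hi2, integral_const_mul,
    integral_finsetSum _ fun σ _ => (integrable_fieldWeight μ σ).mul_const _,
    integral_finsetSum _ fun σ _ => integrable_finsetSum _ fun ρ _ =>
      (integrable_fieldWeight_mul μ σ ρ).mul_const _]
  simp only [integral_mul_const, integral_fieldWeight μ hμ]
  have e5 : ∀ σ : SpinConfig n, ∫ h, ∑ ρ, fieldWeight h σ * fieldWeight h ρ *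
      (min (X σ) L₀ - min (X ρ) L₀) ^ 2 ∂(Measure.pi fun _ : Fin n => μ) =
      ∑ ρ, (∏ i, (1 + τ * (spin σ i * spin ρ i)) / 4) *
        (min (X σ) L₀ - min (X ρ) L₀) ^ 2 := by
    intro σ
    rw [integral_finsetSum _ fun ρ _ => (integrable_fieldWeight_mul μ σ ρ).mul_const _]
    simp only [integral_mul_const, integral_fieldWeight_mul μ hμ]
    rfl
  simp only [e5]
  rw [← Finset.mul_sum]
  have := mul_le_mul_of_nonneg_left hrep hκpos.le
  linarith

end

/-! ### The exponential bound for one observation -/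

/-- Uniform exponential bound for one observation: the clique beats any other set `S'`. -/
theorem exists_plantedMean_exp_le (μ : Measure ℝ) [IsProbabilityMeasure μ]
    (hμ : μ.map (fun x : ℝ => -x) = μ) {θ : ℝ} (hθ : 0 < θ) :
    ∃ s c : ℝ, ∃ K : ℕ, 0 < s ∧ 0 < c ∧ ∀ (n k l : ℕ) (S S' : Finset (Fin n)), K ≤ k →
      S.card = k → S'.card = k → (S' \ S).card = l → 1 ≤ l →
      plantedMean θ μ S (fun σ =>
        Real.exp (s / k * ((∑ i ∈ S', spin σ i) ^ 2 - (∑ i ∈ S, spin σ i) ^ 2))) ≤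
      Real.exp (-(c * (l / k))) := by
  obtain ⟨c, L, hc, hL, hmean⟩ := exists_plantedMean_min_ge μ hμ hθ
  -- `Q` collects the second-order terms: `18 + 12 L` from the exchange estimate and `(3L + 5)²`
  -- from `exp w ≤ 1 + w + w²`. The three bounds on `s` serve the exchange estimate, `|w| ≤ 1`, and
  -- `s Q ≤ c / 4`.
  set Q : ℝ := 18 + 12 * L + (3 * L + 5) ^ 2 with hQ
  have hQ0 : 0 < Q := by positivity
  set s := min (1 / 12) (min (1 / (3 * L + 5)) (c / (4 * Q))) with hs
  have hs0 : 0 < s := by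
    refine lt_min (by norm_num) (lt_min (by positivity) (by positivity))
  have hs1 : s ≤ 1 / 12 := min_le_left _ _
  have hs2 : s * (3 * L + 5) ≤ 1 := by
    rw [← le_div_iff₀ (by positivity)]
    exact (min_le_right _ _).trans (min_le_left _ _)
  have hs3 : s * Q ≤ c / 4 := by
    have : s ≤ c / (4 * Q) := (min_le_right _ _).trans (min_le_right _ _)
    rw [le_div_iff₀ (by positivity)] at this
    linarith
  refine ⟨s, s * c / 2, ⌈4 / c⌉₊ + 2, hs0, by positivity, ?_⟩
  intro n k l S S' hk hS hS' hl hl1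
  have hk2 : 2 ≤ k := by omega
  have hk0 : (0 : ℝ) < k := by exact_mod_cast (by omega : 0 < k)
  have hlk : l ≤ k := by rw [← hl, ← hS']; exact Finset.card_le_card Finset.sdiff_subset
  have hkc : 1 / (k : ℝ) ≤ c / 4 := by
    have h1 : 4 / c ≤ k := (Nat.le_ceil _).trans (by exact_mod_cast (by omega : ⌈4 / c⌉₊ ≤ k))
    rw [div_le_iff₀ hc] at h1
    rw [div_le_iff₀ hk0]
    linarith
  have hk1 : 1 / (k : ℝ) ≤ 1 := by
    rw [div_le_one hk0]; exact_mod_cast (by omega : 1 ≤ k)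
  have hk1' : 0 ≤ 1 / (k : ℝ) := by positivity
  set η : ℝ := l / k with hη
  have hη0 : 0 < η := div_pos (by exact_mod_cast hl1) hk0
  have hη1 : η ≤ 1 := by rw [hη, div_le_one hk0]; exact_mod_cast hlk
  have hsη : 0 < s * η := by positivity
  refine (plantedMean_exp_sub_le θ μ S hμ S' hS hS' hl hl1 hs0.le hs1 hη).trans ?_
  have hpt : ∀ X : ℝ, 0 ≤ X →
      Real.exp (s * η * (-(2 - η) * (X - 1) + 1 / k + 18 * s + 12 * s * X)) ≤
      1 + s * η * ((2 - η) + 1 / k + s * Q) - s * η * (2 - η) * min X L := by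
    intro X hX
    set Y := min X L with hY
    have hY0 : 0 ≤ Y := le_min hX (by linarith)
    have hYL : Y ≤ L := min_le_right _ _
    have hYX : Y ≤ X := min_le_left _ _
    set w := s * η * (-(2 - η) * (Y - 1) + 1 / k + 18 * s + 12 * s * Y) with hw
    -- The coefficient of `X` is `12 s - (2 - η) ≤ 0`, so truncating `X` only increases the exponent
    -- and makes it bounded.
    have h1 : s * η * (-(2 - η) * (X - 1) + 1 / k + 18 * s + 12 * s * X) ≤ w := by
      rw [hw]
      apply mul_le_mul_of_nonneg_left _ hsη.le
      nlinarith [mul_nonneg (sub_nonneg.2 hYX) (show 0 ≤ (2 - η) - 12 * s by linarith)]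
    have hsY : 12 * s * Y ≤ L := by nlinarith
    have hsY0 : 0 ≤ 12 * s * Y := by positivity
    have hηY : 0 ≤ (2 - η) * Y ∧ (2 - η) * Y ≤ 2 * L := by
      constructor
      · exact mul_nonneg (by linarith) hY0
      · nlinarith
    have h2 : |w| ≤ s * η * (3 * L + 5) := by
      rw [hw, abs_mul, abs_of_pos hsη]
      apply mul_le_mul_of_nonneg_left _ hsη.le
      rw [abs_le]
      constructor <;> linarith [hηY.1, hηY.2]
    have h3 : |w| ≤ 1 := by
      refine h2.trans ?_
      calc s * η * (3 * L + 5) = (s * (3 * L + 5)) * η := by ring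
        _ ≤ 1 * 1 := mul_le_mul hs2 hη1 hη0.le zero_le_one
        _ = 1 := one_mul 1
    have h4 := (abs_le.1 (Real.abs_exp_sub_one_sub_id_le h3)).2
    have h5 : w ^ 2 ≤ s * η * (s * (3 * L + 5) ^ 2) := by
      rw [← sq_abs]
      calc |w| ^ 2 ≤ (s * η * (3 * L + 5)) ^ 2 := by gcongr
        _ = (s * η * (s * (3 * L + 5) ^ 2)) * η := by ring
        _ ≤ (s * η * (s * (3 * L + 5) ^ 2)) * 1 := by gcongr
        _ = _ := mul_one _
    have h6 : w ≤ s * η * (-(2 - η) * (Y - 1) + 1 / k + 18 * s + 12 * s * L) := by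
      rw [hw]; gcongr
    have h7 := Real.exp_le_exp.2 h1
    rw [hQ]
    linarith
  have hp : ∀ σ, 0 ≤ plantedProb θ μ S σ := plantedProb_nonneg θ μ S
  refine (plantedMean_mono θ μ S fun σ => hpt ((∑ i ∈ S, spin σ i) ^ 2 / k)
    (by positivity)).trans ?_
  have hlin : plantedMean θ μ S (fun σ => 1 + s * η * ((2 - η) + 1 / k + s * Q) -
      s * η * (2 - η) * min ((∑ i ∈ S, spin σ i) ^ 2 / k) L) =
      1 + s * η * ((2 - η) + 1 / k + s * Q) -
      s * η * (2 - η) * plantedMean θ μ S fun σ => min ((∑ i ∈ S, spin σ i) ^ 2 / k) L := by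
    simp only [plantedMean, mul_sub, Finset.sum_sub_distrib]
    rw [← Finset.sum_mul, sum_plantedProb, one_mul, Finset.mul_sum]
    congr 1
    exact Finset.sum_congr rfl fun σ _ => by ring
  rw [hlin]
  have hm := hmean n S (by omega)
  rw [hS] at hm
  have h1 : s * η * (2 - η) * (1 + c) ≤
      s * η * (2 - η) * plantedMean θ μ S fun σ => min ((∑ i ∈ S, spin σ i) ^ 2 / k) L :=
    mul_le_mul_of_nonneg_left hm (mul_nonneg hsη.le (by linarith))
  -- The drift is at most `-c` since `2 - η ≥ 1`, and the two errors `1 / k` and `s Q` cost `c / 4`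
  -- each: this leaves the rate `s c / 2`.
  have h2 := Real.add_one_le_exp (-(s * c / 2 * η))
  have h3 : s * η * (1 / k) ≤ s * η * (c / 4) := by gcongr
  have h4 : s * η * (s * Q) ≤ s * η * (c / 4) := by gcongr
  have h5 : s * η * c ≤ s * η * (2 - η) * c := by nlinarith [mul_pos hsη hc]
  linarith

/-! ### Union bound and conclusion -/

theorem scanStat_eq {n m : ℕ} (k : ℕ) (x : Fin m → SpinConfig n) (S : Finset (Fin n)) :
    scanStat k x S = 1 / k * (1 / m * ∑ r, (∑ i ∈ S, spin (x r) i) ^ 2 - k) := by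
  unfold scanStat empiricalMoment
  congr 2
  simp only [← Finset.mul_sum]
  congr 1
  simp only [sq, Finset.sum_mul_sum]
  conv_rhs => rw [Finset.sum_comm]
  exact Finset.sum_congr rfl fun i _ => Finset.sum_comm

theorem sum_prod_plantedProb_mul {n : ℕ} (θ : ℝ) (μ : Measure ℝ) (S : Finset (Fin n)) (m : ℕ)
    (F : SpinConfig n → ℝ) :
    ∑ x : Fin m → SpinConfig n, ∏ r, plantedProb θ μ S (x r) * F (x r) =
      plantedMean θ μ S F ^ m := by
  rw [plantedMean, Fintype.sum_pow]

/-- Union bound over all competitors of the clique. -/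
theorem sum_pow_card_symmDiff_le {n : ℕ} (S : Finset (Fin n)) {y : ℝ} (hy : 0 ≤ y) :
    ∑ S' ∈ Finset.univ.erase S, y ^ (symmDiff S S').card ≤ Real.exp (n * y) - 1 := by
  have h1 : ∑ S' : Finset (Fin n), y ^ (symmDiff S S').card =
      ∑ U : Finset (Fin n), y ^ U.card := by
    refine Fintype.sum_equiv (Equiv.mk (symmDiff S) (symmDiff S) ?_ ?_) _ _ fun _ => rfl
    · exact fun U => symmDiff_symmDiff_cancel_left S U
    · exact fun U => symmDiff_symmDiff_cancel_left S U
  have h2 : ∑ U : Finset (Fin n), y ^ U.card = (y + 1) ^ n := by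
    have := Fintype.sum_pow_mul_eq_add_pow (Fin n) y 1
    simpa using this
  have h3 : (y + 1) ^ n ≤ Real.exp (n * y) := by
    rw [Real.exp_nat_mul]
    exact pow_le_pow_left₀ (by linarith) (Real.add_one_le_exp y) n
  have h4 := Finset.add_sum_erase Finset.univ (fun S' => y ^ (symmDiff S S').card)
    (Finset.mem_univ S)
  simp only [symmDiff_self, Finset.bot_eq_empty, Finset.card_empty, pow_zero] at h4
  linarith

/-- Lower bound for the probability of an event that contains the exact recovery of the clique
by every maximiser of the scan statistic. -/
theorem one_sub_le_sampleProb {n m k : ℕ} (θ : ℝ) (μ : Measure ℝ) [IsProbabilityMeasure μ]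
    (S : Finset (Fin n)) (hk : 0 < k) (hm : 0 < m) (hS : S.card = k) {s c : ℝ} (hs : 0 < s)
    (hexp : ∀ S' : Finset (Fin n), S'.card = k → S' ≠ S → plantedMean θ μ S (fun σ =>
        Real.exp (s / k * ((∑ i ∈ S', spin σ i) ^ 2 - (∑ i ∈ S, spin σ i) ^ 2))) ≤
      Real.exp (-(c * ((S' \ S).card / k)))) (E : Set (Fin m → SpinConfig n))
    (hE : ∀ x, (∀ S', IsScanMaximizer k x S' → S' = S) → x ∈ E) :
    1 - (Real.exp (n * Real.exp (-(c * m / (2 * k)))) - 1) ≤ sampleProb θ μ S m E := by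
  classical
  have hk0 : (0 : ℝ) < k := by exact_mod_cast hk
  have hm0 : (0 : ℝ) < m := by exact_mod_cast hm
  set p : SpinConfig n → ℝ := plantedProb θ μ S with hp
  have hp0 : ∀ σ, 0 ≤ p σ := plantedProb_nonneg θ μ S
  set F : Finset (Fin n) → SpinConfig n → ℝ := fun S' σ =>
    Real.exp (s / k * ((∑ i ∈ S', spin σ i) ^ 2 - (∑ i ∈ S, spin σ i) ^ 2)) with hF
  set T := (Finset.univ.erase S).filter fun S' : Finset (Fin n) => S'.card = k with hT
  have htot : ∑ x : Fin m → SpinConfig n, ∏ r, p (x r) = 1 := by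
    rw [← Fintype.sum_pow, hp, sum_plantedProb, one_pow]
  -- Chernoff: off `E` some competitor `S'` has a scan statistic at least that of `S`, so the
  -- product of its factors `F S'` is at least 1.
  have hpt : ∀ x : Fin m → SpinConfig n, ∏ r, p (x r) ≤
      E.indicator (fun y => ∏ r, p (y r)) x + ∑ S' ∈ T, ∏ r, p (x r) * F S' (x r) := by
    intro x
    have hprod : 0 ≤ ∏ r, p (x r) := Finset.prod_nonneg fun r _ => hp0 _
    have hterm : ∀ S' ∈ T, 0 ≤ ∏ r, p (x r) * F S' (x r) := fun S' _ =>
      Finset.prod_nonneg fun r _ => mul_nonneg (hp0 _) (Real.exp_nonneg _)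
    by_cases hx : x ∈ E
    · rw [Set.indicator_of_mem hx]
      linarith [Finset.sum_nonneg hterm]
    · rw [Set.indicator_of_notMem hx, zero_add]
      have hx' : ¬ ∀ S', IsScanMaximizer k x S' → S' = S := fun h => hx (hE x h)
      push Not at hx'
      obtain ⟨S', hmax, hne⟩ := hx'
      have hS'T : S' ∈ T := by simp [hT, hne, hmax.1]
      refine le_trans ?_ (Finset.single_le_sum hterm hS'T)
      rw [Finset.prod_mul_distrib]
      refine le_mul_of_one_le_right hprod ?_
      simp only [hF]
      rw [← Real.exp_sum, ← Finset.mul_sum, Finset.sum_sub_distrib]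
      apply Real.one_le_exp
      have h1 := hmax.2 S hS
      rw [scanStat_eq, scanStat_eq] at h1
      have h2 := le_of_mul_le_mul_left h1 (by positivity)
      have h3 := le_of_mul_le_mul_left (sub_le_sub_iff_right _ |>.1 h2) (by positivity)
      exact mul_nonneg (by positivity) (sub_nonneg.2 h3)
  have hsum := Finset.sum_le_sum fun x (_ : x ∈ Finset.univ) => hpt x
  rw [htot, Finset.sum_add_distrib, Finset.sum_comm] at hsum
  have hbound : ∑ S' ∈ T, ∑ x : Fin m → SpinConfig n, ∏ r, p (x r) * F S' (x r) ≤
      Real.exp (n * Real.exp (-(c * m / (2 * k)))) - 1 := by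
    refine le_trans ?_ (sum_pow_card_symmDiff_le S (Real.exp_nonneg _))
    refine le_trans (Finset.sum_le_sum fun S' hS' => ?_)
      (Finset.sum_le_sum_of_subset_of_nonneg (Finset.filter_subset _ _)
        fun _ _ _ => pow_nonneg (Real.exp_nonneg _) _)
    simp only [hT, Finset.mem_filter, Finset.mem_erase, Finset.mem_univ, and_true] at hS'
    have hcard : (symmDiff S S').card = 2 * (S' \ S).card := by
      rw [symmDiff_def, Finset.sup_eq_union, Finset.card_union_of_disjoint disjoint_sdiff_sdiff,
        Finset.card_sdiff_comm (hS.trans hS'.2.symm)]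
      ring
    rw [sum_prod_plantedProb_mul θ μ S m (F S')]
    have h0 : 0 ≤ plantedMean θ μ S (F S') :=
      Finset.sum_nonneg fun σ _ => mul_nonneg (hp0 σ) (Real.exp_nonneg _)
    refine (pow_le_pow_left₀ h0 (hexp S' hS'.2 hS'.1) m).trans_eq ?_
    rw [hcard, ← Real.exp_nat_mul, ← Real.exp_nat_mul]
    congr 1
    push_cast
    field_simp
  unfold sampleProb
  linarith

theorem mainTheorem9 (μ : MeasureTheory.Measure ℝ) [MeasureTheory.IsProbabilityMeasure μ]
    (hμ : μ.map (fun x : ℝ => -x) = μ) (θ : ℝ) (hθ : 0 < θ)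
    (hhigh : θ < 1 / ∫ x : ℝ, 1 / Real.cosh x ^ 2 ∂μ) :
    ∃ C : ℝ, 0 < C ∧ ∀ ε : ℝ, 0 < ε → ∀ δ : ℝ, 0 < δ → ∃ K : ℕ,
      ∀ n k m : ℕ, K ≤ k → C * (k : ℝ) * Real.log (n : ℝ) ≤ (m : ℝ) →
        ∀ S₀ : Finset (Fin n), S₀.card = k →
          1 - δ ≤ sampleProb θ μ S₀ m
            {x | ∀ S : Finset (Fin n), IsScanMaximizer k x S →
              ((symmDiff S₀ S).card : ℝ) ≤ ε * (k : ℝ)} := by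
  obtain ⟨s, c, K₀, hs, hc, hone⟩ := exists_plantedMean_exp_le μ hμ hθ
  -- With `C = 4 / c` the factor per site of `S Δ S'` is at most `n⁻²`, so the failure probability
  -- is at most `exp (1/n) - 1 ≤ 2 / n ≤ δ`, because `n ≥ k ≥ 2 / δ`. The `+ 2` ensures `log n > 0`.
  refine ⟨4 / c, by positivity, fun ε hε δ hδ => ⟨K₀ + ⌈2 / δ⌉₊ + 2, ?_⟩⟩
  intro n k m hk hm S₀ hS₀
  have hkn : k ≤ n := by
    rw [← hS₀]; simpa using Finset.card_le_univ S₀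
  have hk0 : (0 : ℝ) < k := by exact_mod_cast (by omega : 0 < k)
  have hn0 : (0 : ℝ) < n := by exact_mod_cast (by omega : 0 < n)
  have hn1 : (1 : ℝ) < n := by exact_mod_cast (by omega : 1 < n)
  have hlog : 0 < Real.log n := Real.log_pos hn1
  -- The case `m = 0` must be excluded: there `1 / m` is 0 and every `k`-set is a maximizer.
  have hm0 : 0 < m := by
    have : (0 : ℝ) < m := lt_of_lt_of_le (by positivity) hm
    exact_mod_cast this
  have hmain := one_sub_le_sampleProb (m := m) (k := k) θ μ S₀ (by omega) hm0 hS₀ hs (c := c)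
    (fun S' hS' hne => hone n k _ S₀ S' (by omega) hS₀ hS' rfl (by
      rw [Nat.one_le_iff_ne_zero, Finset.card_ne_zero, Finset.sdiff_nonempty]
      exact fun h => hne (Finset.eq_of_subset_of_card_le h (by omega))))
    {x | ∀ S : Finset (Fin n), IsScanMaximizer k x S →
      ((symmDiff S₀ S).card : ℝ) ≤ ε * (k : ℝ)}
    (fun x hx S hS => by
      rw [hx S hS]
      simp only [symmDiff_self, Finset.bot_eq_empty, Finset.card_empty, Nat.cast_zero]
      positivity)
  refine le_trans ?_ hmain
  have hy : Real.exp (-(c * m / (2 * k))) ≤ 1 / (n : ℝ) ^ 2 := by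
    have h1 : 2 * Real.log n ≤ c * m / (2 * k) := by
      rw [le_div_iff₀ (by positivity)]
      calc 2 * Real.log n * (2 * k) = c * (4 / c * k * Real.log n) := by field_simp; ring
        _ ≤ c * m := by gcongr
    calc Real.exp (-(c * m / (2 * k))) ≤ Real.exp (-(2 * Real.log n)) := by gcongr
      _ = 1 / (n : ℝ) ^ 2 := by
        rw [Real.exp_neg, one_div, show 2 * Real.log n = Real.log n + Real.log n by ring,
          Real.exp_add, Real.exp_log hn0, sq]
  have hny : n * Real.exp (-(c * m / (2 * k))) ≤ 1 / n := by
    calc n * Real.exp (-(c * m / (2 * k))) ≤ n * (1 / (n : ℝ) ^ 2) := by gcongr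
      _ = 1 / n := by field_simp
  have hn1' : 1 / (n : ℝ) ≤ 1 := by rw [div_le_one hn0]; exact hn1.le
  have hexp : Real.exp (1 / n) - 1 ≤ 2 * (1 / n) := by
    have := (abs_le.1 (Real.abs_exp_sub_one_le
      (show |1 / (n : ℝ)| ≤ 1 by rwa [abs_of_nonneg (by positivity)]))).2
    rwa [abs_of_nonneg (by positivity)] at this
  have hδn : 2 * (1 / (n : ℝ)) ≤ δ := by
    have h1 : 2 / δ ≤ n := (Nat.le_ceil _).trans (by exact_mod_cast (by omega : ⌈2 / δ⌉₊ ≤ n))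
    rw [div_le_iff₀ hδ] at h1
    rw [mul_one_div, div_le_iff₀ hn0]
    linarith
  have := Real.exp_le_exp.2 hny
  linarith
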